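/- Let $u$ and $v$ be the canonical solutions on $\mathbb R$ of the Airy equation $y''=xy$, with $u(0)=1$, $u'(0)=0$ and $v(0)=0$, $v'(0)=1$. For $j\ge 0$ let $-c_{2j}$, $-c_{2j+1}$, $-\tilde c_{2j}$, $-\tilde c_{2j+1}$ denote the $(j+1)$-st negative zero, in decreasing order, of $v'$, $v$, $u$, $u'$ respectively. These sequences are well defined and infinite; the zero set of $v'$ is $\{-c_{2j}\}_{j\ge0}$, that of $v$ is $\{-c_{2j+1}\}_{j\ge0}\cup\{0\}$, that of $u$ is $\{-\tilde c_{2j}\}_{j\ge0}$ and that of $u'$ is $\{-\tilde c_{2j+1}\}_{j\ge0}\cup\{0\}$. Put $\xi_p=\frac23 c_p^{3/2}$ and $\tilde\xi_p=\frac23\tilde c_p^{3/2}$. Then: (a) For every integer $j\ge0$, $$\left|\xi_{2j}-\tfrac{5\pi}{12}-j\pi\right|\le\frac{7}{12(j\pi+\frac{\pi}{3})},\qquad \left|\xi_{2j+1}-\tfrac{11\pi}{12}-j\pi\right|\le\frac{5}{36(j\pi+\frac{5\pi}{6})},$$ $$\left|\tilde\xi_{2j}-\tfrac{7\pi}{12}-j\pi\right|\le\frac{5}{36(j\pi+\frac{\pi}{2})},\qquad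 \left|\tilde\xi_{2j+1}-\tfrac{13\pi}{12}-j\pi\right|\le\frac{7}{12(j+1)\pi}.$$ (b) As $j\to\infty$, $$c_{2j}=\left(\tfrac{3j\pi}{2}\right)^{\frac23}\left(1+\tfrac{5}{18j}+\mathcal O(j^{-2})\right),\qquad c_{2j+1}=\left(\tfrac{3j\pi}{2}\right)^{\frac23}\left(1+\tfrac{11}{18j}+\mathcal O(j^{-2})\right),$$ $$\tilde c_{2j}=\left(\tfrac{3j\pi}{2}\right)^{\frac23}\left(1+\tfrac{7}{18j}+\mathcal O(j^{-2})\right),\qquad \tilde c_{2j+1}=\left(\tfrac{3j\pi}{2}\right)^{\frac23}\left(1+\tfrac{13}{18j}+\mathcal O(j^{-2})\right).$$ (c) As $p\to\infty$, $$c_p=\left(\tfrac{3p\pi}{4}\right)^{\frac23}+\mathcal O\left(p^{-\frac13}\right),\qquad \tilde c_p-c_p=\left(\tfrac{\pi}{9\sqrt2}\right)^{\frac23}p^{-\frac13}+\mathcal O\left(p^{-\frac43}\right).$$ -/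

import Mathlib

open Filter Asymptotics

namespace CanonicalAiry

/-- Taylor coefficients at `0` of the solution of `y'' = x y` with `y 0 = α`, `y' 0 = β`. -/
noncomputable def coeff (α β : ℝ) : ℕ → ℝ
  | 0 => α
  | 1 => β
  | 2 => 0
  | n + 3 => coeff α β n / (((n : ℝ) + 3) * ((n : ℝ) + 2))

/-- The solution of the Airy equation `y'' = x y` with `y 0 = α`, `y' 0 = β`, as an everywhere
convergent power series. -/
noncomputable def sol (α β : ℝ) (x : ℝ) : ℝ := ∑' n : ℕ, coeff α β n * x ^ n

/-- The canonical solution with `u 0 = 1`, `u' 0 = 0`. -/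
noncomputable def u : ℝ → ℝ := sol 1 0

/-- The canonical solution with `v 0 = 0`, `v' 0 = 1`. -/
noncomputable def v : ℝ → ℝ := sol 0 1

/-- The positive numbers `x` such that `f (-x) = 0`, listed in increasing order: the opposites of
the negative zeroes of `f` in decreasing order, starting with the one closest to `0`. -/
noncomputable def negZero (f : ℝ → ℝ) : ℕ → ℝ
  | 0 => sInf {x : ℝ | 0 < x ∧ f (-x) = 0}
  | j + 1 => sInf {x : ℝ | negZero f j < x ∧ f (-x) = 0}

/-- `-c (2 * j)` are the negative zeroes of `v'`, and `-c (2 * j + 1)` those of `v`. -/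
noncomputable def c (p : ℕ) : ℝ :=
  if Even p then negZero (deriv v) (p / 2) else negZero v (p / 2)

/-- `-ct (2 * j)` are the negative zeroes of `u`, and `-ct (2 * j + 1)` those of `u'`. -/
noncomputable def ct (p : ℕ) : ℝ :=
  if Even p then negZero u (p / 2) else negZero (deriv u) (p / 2)

/-- `ξ_p = (2/3) c_p ^ (3/2)`. -/
noncomputable def xi (p : ℕ) : ℝ := 2 / 3 * c p ^ (3 / 2 : ℝ)

/-- The same quantity for the sequence `ct`. -/
noncomputable def xit (p : ℕ) : ℝ := 2 / 3 * ct p ^ (3 / 2 : ℝ)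

/-! The series `sol α β` is indeed the solution of `y'' = x y` with `y 0 = α`, `y' 0 = β`. -/

theorem coeff_bound (α β R : ℝ) (hR : 0 < R) : ∃ C, ∀ n, |coeff α β n| * R ^ n ≤ C := by
  obtain ⟨N, hN⟩ := exists_nat_ge (R ^ 3)
  have hnn : ∀ n, 0 ≤ |coeff α β n| * R ^ n := fun n => by positivity
  refine ⟨∑ i ∈ Finset.range (N + 3), |coeff α β i| * R ^ i, fun n => ?_⟩
  induction n using Nat.strong_induction_on with
  | _ n ih =>
    by_cases h : n < N + 3
    · exact Finset.single_le_sum (f := fun i => |coeff α β i| * R ^ i) (fun i _ => hnn i)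
        (Finset.mem_range.2 h)
    · obtain ⟨m, rfl⟩ : ∃ m, n = m + 3 := ⟨n - 3, by omega⟩
      refine le_trans ?_ (ih m (by omega))
      have hm : (N : ℝ) ≤ m := by exact_mod_cast (by omega : N ≤ m)
      have hpos : (0 : ℝ) < ((m : ℝ) + 3) * ((m : ℝ) + 2) := by positivity
      have e : |coeff α β (m + 3)| * R ^ (m + 3)
          = (|coeff α β m| * R ^ m) * (R ^ 3 / (((m : ℝ) + 3) * ((m : ℝ) + 2))) := by
        rw [coeff, abs_div, abs_of_pos hpos]
        ring
      rw [e]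
      refine mul_le_of_le_one_right (hnn m) ((div_le_one hpos).2 ?_)
      have : (0 : ℝ) ≤ m := by positivity
      nlinarith

theorem hasDerivAt_series (a : ℕ → ℝ) (ha : ∀ R : ℝ, 0 < R → ∃ C, ∀ n, |a n| * R ^ n ≤ C)
    (x : ℝ) : HasDerivAt (fun y : ℝ => ∑' n : ℕ, a n * y ^ n)
      (∑' n : ℕ, ((n : ℝ) + 1) * a (n + 1) * x ^ n) x := by
  set r : ℝ := |x| + 1 with hr
  have hr1 : 1 ≤ r := by have := abs_nonneg x; linarith
  obtain ⟨C, hC⟩ := ha (2 * r) (by linarith)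
  have hs : Summable fun n : ℕ => C * ((n : ℝ) ^ 1 * (1 / 2 : ℝ) ^ n) :=
    (summable_pow_mul_geometric_of_norm_lt_one 1
      (by norm_num : ‖(1 / 2 : ℝ)‖ < 1)).mul_left C
  have hb : ∀ (n : ℕ) (y : ℝ), y ∈ Metric.ball (0 : ℝ) r →
      ‖a n * ((n : ℝ) * y ^ (n - 1))‖ ≤ C * ((n : ℝ) ^ 1 * (1 / 2 : ℝ) ^ n) := by
    intro n y hy
    have hy' : |y| ≤ r := by
      have := mem_ball_zero_iff.1 hy
      rw [Real.norm_eq_abs] at this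
      exact this.le
    have h1 : |y| ^ (n - 1) ≤ r ^ n :=
      (pow_le_pow_left₀ (abs_nonneg y) hy' _).trans (pow_le_pow_right₀ hr1 (Nat.sub_le n 1))
    have h2 : |a n| * r ^ n ≤ C * (1 / 2 : ℝ) ^ n := by
      have := mul_le_mul_of_nonneg_right (hC n) (by positivity : (0 : ℝ) ≤ (1 / 2 : ℝ) ^ n)
      refine le_trans (le_of_eq ?_) this
      rw [mul_assoc, ← mul_pow]
      congr 2
      ring
    rw [norm_mul, norm_mul, norm_pow, Real.norm_eq_abs, Real.norm_eq_abs, Real.norm_eq_abs,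
      Nat.abs_cast]
    calc |a n| * ((n : ℝ) * |y| ^ (n - 1)) ≤ |a n| * ((n : ℝ) * r ^ n) := by gcongr
      _ = (n : ℝ) * (|a n| * r ^ n) := by ring
      _ ≤ (n : ℝ) * (C * (1 / 2 : ℝ) ^ n) := by gcongr
      _ = _ := by ring
  have hx : x ∈ Metric.ball (0 : ℝ) r := by
    rw [mem_ball_zero_iff, Real.norm_eq_abs]; linarith
  have h0 : (0 : ℝ) ∈ Metric.ball (0 : ℝ) r := by
    rw [mem_ball_zero_iff, norm_zero]; linarith
  have key := hasDerivAt_tsum_of_isPreconnected (g := fun n (y : ℝ) => a n * y ^ n)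
    (g' := fun n (y : ℝ) => a n * ((n : ℝ) * y ^ (n - 1))) hs Metric.isOpen_ball
    (convex_ball (0 : ℝ) r).isPreconnected
    (fun n y _ => (hasDerivAt_pow n y).const_mul (a n)) hb h0
    (summable_of_ne_finset_zero (s := {0}) fun n hn => by
      simp only [Finset.mem_singleton] at hn
      simp [hn]) hx
  have hs' : Summable fun n : ℕ => a n * ((n : ℝ) * x ^ (n - 1)) :=
    Summable.of_norm_bounded hs fun n => hb n x hx
  rw [hs'.tsum_eq_zero_add] at key
  convert! key using 1
  simp only [Nat.cast_zero, zero_mul, mul_zero, zero_add, Nat.cast_add, Nat.cast_one,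
    Nat.add_sub_cancel]
  exact tsum_congr fun n => by ring

theorem deriv_coeff_bound (a : ℕ → ℝ) (ha : ∀ R : ℝ, 0 < R → ∃ C, ∀ n, |a n| * R ^ n ≤ C)
    (R : ℝ) (hR : 0 < R) : ∃ C, ∀ n : ℕ, |((n : ℝ) + 1) * a (n + 1)| * R ^ n ≤ C := by
  obtain ⟨C, hC⟩ := ha (2 * R) (by linarith)
  refine ⟨C / R, fun n => ?_⟩
  rw [le_div_iff₀ hR]
  refine le_trans ?_ (hC (n + 1))
  have h2 : ((n : ℝ) + 1) ≤ 2 ^ (n + 1) := by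
    exact_mod_cast (Nat.lt_two_pow_self (n := n + 1)).le
  rw [abs_mul, abs_of_nonneg (by positivity : (0 : ℝ) ≤ (n : ℝ) + 1), mul_pow]
  calc ((n : ℝ) + 1) * |a (n + 1)| * R ^ n * R
      = ((n : ℝ) + 1) * (|a (n + 1)| * R ^ (n + 1)) := by ring
    _ ≤ 2 ^ (n + 1) * (|a (n + 1)| * R ^ (n + 1)) := by gcongr
    _ = _ := by ring

theorem hasDerivAt_sol (α β x : ℝ) : HasDerivAt (sol α β) (deriv (sol α β) x) x :=
  (hasDerivAt_series _ (coeff_bound α β) x).differentiableAt.hasDerivAt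

theorem deriv_sol (α β : ℝ) : deriv (sol α β) =
    fun x => ∑' n : ℕ, ((n : ℝ) + 1) * coeff α β (n + 1) * x ^ n :=
  funext fun x => (hasDerivAt_series _ (coeff_bound α β) x).deriv

/-- The Airy equation. -/
theorem hasDerivAt_deriv_sol (α β x : ℝ) :
    HasDerivAt (deriv (sol α β)) (x * sol α β x) x := by
  rw [deriv_sol]
  have hb := deriv_coeff_bound _ (coeff_bound α β)
  have h := hasDerivAt_series (fun n : ℕ => ((n : ℝ) + 1) * coeff α β (n + 1)) hb x
  convert! h using 1
  have e : ∀ n : ℕ, ((n + 1 : ℕ) + 1 : ℝ) *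
      ((((n + 1 : ℕ) : ℝ) + 1 + 1) * coeff α β (n + 1 + 1 + 1)) * x ^ (n + 1)
      = x * (coeff α β n * x ^ n) := by
    intro n
    rw [coeff]
    push_cast
    field_simp
    ring
  obtain ⟨C, hC⟩ := deriv_coeff_bound _ hb (2 * (|x| + 1)) (by positivity)
  have hs : Summable fun n : ℕ => ((n : ℝ) + 1) *
      ((((n + 1 : ℕ) : ℝ) + 1) * coeff α β (n + 1 + 1)) * x ^ n := by
    refine Summable.of_norm_bounded
      ((summable_geometric_two).mul_left C) fun n => ?_
    rw [norm_mul, norm_pow, Real.norm_eq_abs, Real.norm_eq_abs]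
    have h3 : |x| ^ n ≤ (2 * (|x| + 1)) ^ n * (1 / 2 : ℝ) ^ n := by
      rw [← mul_pow]
      exact pow_le_pow_left₀ (abs_nonneg x) (by linarith) n
    calc _ ≤ |((n : ℝ) + 1) * ((((n + 1 : ℕ) : ℝ) + 1) * coeff α β (n + 1 + 1))| *
          ((2 * (|x| + 1)) ^ n * (1 / 2 : ℝ) ^ n) := by gcongr
      _ = |((n : ℝ) + 1) * ((((n + 1 : ℕ) : ℝ) + 1) * coeff α β (n + 1 + 1))| *
          (2 * (|x| + 1)) ^ n * (1 / 2 : ℝ) ^ n := by ring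
      _ ≤ _ := by
        gcongr
        exact hC n
  rw [hs.tsum_eq_zero_add, sol, ← tsum_mul_left]
  have z : coeff α β (0 + 1 + 1) = 0 := rfl
  rw [z]
  simp only [mul_zero, zero_mul, zero_add]
  refine tsum_congr fun n => ?_
  rw [← e n]
  push_cast
  ring

theorem sol_zero (α β : ℝ) : sol α β 0 = α := by
  rw [sol, tsum_eq_single 0 fun n hn => by simp [hn]]
  simp [coeff]

theorem deriv_sol_zero (α β : ℝ) : deriv (sol α β) 0 = β := by
  rw [deriv_sol]
  beta_reduce
  rw [tsum_eq_single 0 fun n hn => by simp [hn]]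
  simp [coeff]

end CanonicalAiry

/-!
The zeroes are located in the variable `ξ = (2/3) x ^ (3/2)`, where `-x` is the point of the
negative half-line at which a solution `f` of the Airy equation is evaluated. There
`ξ^{1/6} f(-x)` and `ξ^{-1/6} f'(-x)` solve `w'' + (1 + Q / ξ²) w = 0` with `Q = 5/36` and
`Q = -7/36` respectively; in both cases `Q = -a (a + 1)`, with `a = -1/6` and `a = 1/6`
(`solWave_isWave`, `derivWave_isWave`).

In polar coordinates `w = R sin θ`, `w' = R cos θ` the equation becomes
`θ' = 1 + (Q / ξ²) sin² θ`. Hence `θ - ξ` has a limit `φ` at infinity and differs from it by at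
most `|Q| / ξ`, so that the zeroes of `w`, being the points where `θ ∈ π ℤ`, satisfy
`ξ = n π - φ + O(|Q| / ξ)` with an explicit constant (`IsWave.exists_normalized_phase`,
`IsWave.exists_zeros`). The zeroes are then known once `φ` is known modulo `π` and the integer `n`
of the first one is known. The latter is found from crude bounds: there is no zero with `ξ ≤ 1`,
by integrating the Airy equation from `0`, and the first one is at most `1 + π + |Q|`
(`IsWave.exists_indexed_zeros`).

The value of `φ` modulo `π` is a connection problem between `0` and `∞`. It is solved by the
complex solution `e^{iξ} ξ^{a+1} ∫₀^∞ e^{-ξ s} (s + i s²/2)^a ds`, of Hankel type. By dominated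
convergence, it is `e^{iξ} Γ(a+1) (1 + o(1))` at infinity, and a real multiple of
`e^{i a π / 2} ξ^{-a} (1 + o(1))` at `0` (`hankelMoment_tendsto_atTop`,
`hankelMoment_tendsto_zero`). So the imaginary part of its product with `e^{-i a π / 2}` is a
solution that is small at `0`, and thereby proportional to the recessive one, which is the wave of
`v` if `a = -1/6` and the wave of `u'` if `a = 1/6`; its phase at infinity is `ξ - a π / 2`
(`IsWave.sin_tendsto_of_recessive`). The phases of `v'` and `u` follow from those of `v` and `u'`,
since a zero of `v'` or `u` is nearly a critical point of the wave of `v` or `u'`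
(`IsWave.sin_tendsto_of_critical`).

The expansions come from the bounds for `ξ` and from `|(1 + h)^{2/3} - 1 - 2 h / 3| ≤ h²`; for
those along all indices, note that the even and odd zeroes satisfy the same law
`ξ_p = p π / 2 + 5 π / 12 + O(1/p)`, and similarly with `7 π / 12`.
-/

/-! ### A Laplace integral of Hankel type -/

namespace CanonicalAiry

open MeasureTheory Set Complex Topology

/-- The power `(x r + i y r² / 2)^a`. The Laplace integral has `x = y = 1`; the two weights are
there for its rescalings, whose limits are the cases `y = 0` and `x = 0`. -/
noncomputable def hankelKernel (a x y r : ℝ) : ℂ :=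
  (((x * r : ℝ) : ℂ) + ((y * r ^ 2 / 2 : ℝ) : ℂ) * I) ^ (a : ℂ)

theorem hankelBase_mem_slitPlane {x y r : ℝ} (hx : 0 ≤ x) (hy : 0 ≤ y) (hxy : x = 1 ∨ y = 1)
    (hr : 0 < r) : ((x * r : ℝ) : ℂ) + ((y * r ^ 2 / 2 : ℝ) : ℂ) * I ∈ slitPlane := by
  rw [mem_slitPlane_iff]
  rcases hxy with rfl | rfl
  · left
    simp only [add_re, mul_re, ofReal_re, ofReal_im, I_re, I_im]
    linarith
  · right
    simp only [add_im, mul_im, ofReal_re, ofReal_im, I_re, I_im]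
    positivity

/-- A bound uniform in the weights, integrable at `0` since `2 a > -1`: it dominates all the
rescaled integrals at once. -/
theorem norm_hankelKernel_le {a x y r : ℝ} (ha : |a| < 1 / 2) (hx : 0 ≤ x) (hy : 0 ≤ y)
    (hx1 : x ≤ 1) (hy1 : y ≤ 1) (hxy : x = 1 ∨ y = 1) (hr : 0 < r) :
    ‖hankelKernel a x y r‖ ≤ 2 * (r ^ a + r ^ (2 * a)) := by
  obtain ⟨ha1, ha2⟩ := abs_lt.1 ha
  rw [hankelKernel, norm_cpow_real]
  set z : ℂ := ((x * r : ℝ) : ℂ) + ((y * r ^ 2 / 2 : ℝ) : ℂ) * I with hz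
  have hre : z.re = x * r := by
    simp only [hz, add_re, mul_re, ofReal_re, ofReal_im, I_re, I_im]; ring
  have him : z.im = y * r ^ 2 / 2 := by
    simp only [hz, add_im, mul_im, ofReal_re, ofReal_im, I_re, I_im]; ring
  have hpa : 0 < r ^ a := Real.rpow_pos_of_pos hr a
  have h2 : (r ^ 2) ^ a = r ^ (2 * a) := by
    rw [← Real.rpow_natCast, ← Real.rpow_mul hr.le]; norm_num
  have hpb : 0 < r ^ (2 * a) := Real.rpow_pos_of_pos hr _
  rcases le_or_gt 0 a with h | h
  · have hle : ‖z‖ ≤ r + r ^ 2 := by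
      refine (norm_le_abs_re_add_abs_im z).trans ?_
      rw [hre, him, abs_of_nonneg (by positivity), abs_of_nonneg (by positivity)]
      nlinarith [sq_nonneg r]
    calc ‖z‖ ^ a ≤ (r + r ^ 2) ^ a := Real.rpow_le_rpow (norm_nonneg _) hle h
      _ ≤ r ^ a + (r ^ 2) ^ a :=
        Real.rpow_add_le_add_rpow hr.le (by positivity) h (by linarith)
      _ ≤ _ := by rw [h2]; linarith
  · rcases hxy with rfl | rfl
    · have hge : r ≤ ‖z‖ := by
        refine le_trans ?_ (abs_re_le_norm z)
        rw [hre, one_mul]; exact le_abs_self r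
      have := Real.rpow_le_rpow_of_nonpos hr hge h.le
      linarith
    · have hge : r ^ 2 / 2 ≤ ‖z‖ := by
        refine le_trans ?_ (abs_im_le_norm z)
        rw [him, one_mul]; exact le_abs_self _
      have h3 := Real.rpow_le_rpow_of_nonpos (by positivity) hge h.le
      have h4 : (r ^ 2 / 2) ^ a = r ^ (2 * a) * (2 : ℝ) ^ (-a) := by
        rw [Real.div_rpow (by positivity) (by norm_num), h2, Real.rpow_neg (by norm_num)]; rfl
      have h5 : (2 : ℝ) ^ (-a) ≤ 2 := by
        calc (2 : ℝ) ^ (-a) ≤ 2 ^ (1 : ℝ) :=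
              Real.rpow_le_rpow_of_exponent_le (by norm_num) (by linarith)
          _ = 2 := by norm_num
      nlinarith

theorem continuousOn_hankelKernel {a x y : ℝ} (hx : 0 ≤ x) (hy : 0 ≤ y) (hxy : x = 1 ∨ y = 1) :
    ContinuousOn (hankelKernel a x y) (Ioi 0) := by
  intro r hr
  refine ContinuousAt.continuousWithinAt ?_
  refine (continuousAt_cpow_const (hankelBase_mem_slitPlane hx hy hxy hr)).comp
    (f := fun r : ℝ => ((x * r : ℝ) : ℂ) + ((y * r ^ 2 / 2 : ℝ) : ℂ) * I) ?_
  fun_prop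

theorem real_mul_cpow {c : ℝ} (hc : 0 < c) {z : ℂ} (hz : z ≠ 0) (a : ℝ) :
    ((c : ℂ) * z) ^ (a : ℂ) = ((c ^ a : ℝ) : ℂ) * z ^ (a : ℂ) := by
  have hc' : (c : ℂ) ≠ 0 := ofReal_ne_zero.2 hc.ne'
  rw [cpow_def_of_ne_zero (mul_ne_zero hc' hz), log_ofReal_mul hc hz, ofReal_log hc.le, add_mul,
    exp_add, ← cpow_def_of_ne_zero hc', ← cpow_def_of_ne_zero hz, ofReal_cpow hc.le]

theorem integrableOn_exp_rpow {b c : ℝ} (hb : 0 < b) (hc : -1 < c) :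
    IntegrableOn (fun s : ℝ => Real.exp (-b * s) * s ^ c) (Ioi 0) := by
  have := integrableOn_rpow_mul_exp_neg_mul_rpow (p := 1) hc one_pos hb
  simpa [mul_comm] using this

theorem integrableOn_hankelBound {a b : ℝ} (ha : |a| < 1 / 2) (hb : 0 < b) (k : ℕ) :
    IntegrableOn (fun s : ℝ => Real.exp (-b * s) * s ^ k * (2 * (s ^ a + s ^ (2 * a))))
      (Ioi 0) := by
  obtain ⟨ha1, ha2⟩ := abs_lt.1 ha
  have hk : (0 : ℝ) ≤ k := by positivity
  have h1 := integrableOn_exp_rpow (c := k + a) hb (by linarith)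
  have h2 := integrableOn_exp_rpow (c := k + 2 * a) hb (by linarith)
  refine IntegrableOn.congr_fun ((h1.add h2).const_mul 2) (fun s hs => ?_) measurableSet_Ioi
  have hs' : (0 : ℝ) < s := hs
  simp only [Pi.add_apply]
  rw [Real.rpow_add hs', Real.rpow_add hs', Real.rpow_natCast]
  ring

/-- The moment `L_k(ξ) = ∫₀^∞ e^{-ξ s} s^k (s + i s² / 2)^a ds`. -/
noncomputable def hankelMoment (a : ℝ) (k : ℕ) (ξ : ℝ) : ℂ :=
  ∫ s in Ioi (0 : ℝ), ((Real.exp (-ξ * s) * s ^ k : ℝ) : ℂ) * hankelKernel a 1 1 s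

theorem aestronglyMeasurable_hankel {a x y : ℝ} (hx : 0 ≤ x) (hy : 0 ≤ y) (hxy : x = 1 ∨ y = 1)
    (k : ℕ) (ξ : ℝ) : AEStronglyMeasurable
      (fun s : ℝ => ((Real.exp (-ξ * s) * s ^ k : ℝ) : ℂ) * hankelKernel a x y s)
      (volume.restrict (Ioi 0)) := by
  refine ContinuousOn.aestronglyMeasurable ?_ measurableSet_Ioi
  refine ContinuousOn.mul ?_ (continuousOn_hankelKernel hx hy hxy)
  fun_prop

theorem norm_hankelIntegrand_le {a x y : ℝ} (ha : |a| < 1 / 2) (hx : 0 ≤ x) (hy : 0 ≤ y)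
    (hx1 : x ≤ 1) (hy1 : y ≤ 1) (hxy : x = 1 ∨ y = 1) {ξ b s : ℝ} (hb : b ≤ ξ) (hs : 0 < s)
    (k : ℕ) :
    ‖((Real.exp (-ξ * s) * s ^ k : ℝ) : ℂ) * hankelKernel a x y s‖ ≤
      Real.exp (-b * s) * s ^ k * (2 * (s ^ a + s ^ (2 * a))) := by
  rw [norm_mul, norm_real, Real.norm_of_nonneg (by positivity)]
  have h1 : Real.exp (-ξ * s) ≤ Real.exp (-b * s) := Real.exp_le_exp.2 (by nlinarith)
  have h2 := norm_hankelKernel_le ha hx hy hx1 hy1 hxy hs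
  gcongr

theorem integrable_hankel {a : ℝ} (ha : |a| < 1 / 2) {ξ : ℝ} (hξ : 0 < ξ) (k : ℕ) :
    IntegrableOn (fun s : ℝ => ((Real.exp (-ξ * s) * s ^ k : ℝ) : ℂ) * hankelKernel a 1 1 s)
      (Ioi 0) := by
  refine Integrable.mono' (integrableOn_hankelBound ha hξ k)
    (aestronglyMeasurable_hankel zero_le_one zero_le_one (Or.inl rfl) k ξ) ?_
  filter_upwards [ae_restrict_mem measurableSet_Ioi] with s hs
  exact norm_hankelIntegrand_le ha zero_le_one zero_le_one le_rfl le_rfl (Or.inl rfl) le_rfl hs k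

theorem hasDerivAt_hankelMoment {a : ℝ} (ha : |a| < 1 / 2) (k : ℕ) {ξ : ℝ} (hξ : 0 < ξ) :
    HasDerivAt (hankelMoment a k) (-hankelMoment a (k + 1) ξ) ξ := by
  have hmeas := fun (k : ℕ) (ξ : ℝ) =>
    aestronglyMeasurable_hankel (a := a) zero_le_one zero_le_one (Or.inl rfl) k ξ
  have key := hasDerivAt_integral_of_dominated_loc_of_deriv_le (𝕜 := ℝ)
    (μ := volume.restrict (Ioi (0 : ℝ))) (x₀ := ξ) (s := Ioi (ξ / 2))
    (bound := fun s => Real.exp (-(ξ / 2) * s) * s ^ (k + 1) * (2 * (s ^ a + s ^ (2 * a))))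
    (F := fun ξ s => ((Real.exp (-ξ * s) * s ^ k : ℝ) : ℂ) * hankelKernel a 1 1 s)
    (F' := fun ξ s => -(((Real.exp (-ξ * s) * s ^ (k + 1) : ℝ) : ℂ) * hankelKernel a 1 1 s))
    (Ioi_mem_nhds (by linarith)) (Eventually.of_forall fun x => hmeas k x)
    (integrable_hankel ha hξ k) (hmeas (k + 1) ξ).neg ?_
    (integrableOn_hankelBound ha (by linarith) (k + 1)) ?_
  · have h := key.2
    rw [integral_neg] at h
    exact h
  · filter_upwards [ae_restrict_mem measurableSet_Ioi] with s hs x hx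
    rw [norm_neg]
    exact norm_hankelIntegrand_le ha zero_le_one zero_le_one le_rfl le_rfl (Or.inl rfl)
      (le_of_lt hx) hs (k + 1)
  · filter_upwards with s x _
    have h1 : HasDerivAt (fun x : ℝ => Real.exp (-x * s) * s ^ k)
        (-(Real.exp (-x * s) * s ^ (k + 1))) x := by
      have := (((hasDerivAt_id x).neg.mul_const s).exp).mul_const (s ^ k)
      convert! this using 1
      simp only [Pi.neg_apply, id]
      ring
    have := h1.ofReal_comp.mul_const (hankelKernel a 1 1 s)
    convert! this using 1
    push_cast
    ring

/-- The differential equation of `L₀` (as `L_k' = -L_{k+1}`), obtained by integrating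
`d/ds (e^{-ξ s} (s + i s² / 2)^{a + 1})` over `(0, ∞)`. -/
theorem hankelMoment_recurrence {a : ℝ} (ha : |a| < 1 / 2) {ξ : ℝ} (hξ : 0 < ξ) :
    ξ * hankelMoment a 2 ξ * I / 2 + ξ * hankelMoment a 1 ξ
      - (a + 1) * (hankelMoment a 0 ξ + I * hankelMoment a 1 ξ) = 0 := by
  obtain ⟨ha1, ha2⟩ := abs_lt.1 ha
  set p : ℝ → ℂ := fun r => ((1 * r : ℝ) : ℂ) + ((1 * r ^ 2 / 2 : ℝ) : ℂ) * I with hp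
  have hslit : ∀ s : ℝ, 0 < s → p s ∈ slitPlane := fun s hs =>
    hankelBase_mem_slitPlane zero_le_one zero_le_one (Or.inl rfl) hs
  have hp' : ∀ s : ℝ, HasDerivAt p (1 + s * I) s := by
    intro s
    have h1 : HasDerivAt (fun r : ℝ => 1 * r) 1 s := by
      simpa using (hasDerivAt_id' s).const_mul (1 : ℝ)
    have h2 : HasDerivAt (fun r : ℝ => 1 * r ^ 2 / 2) s s := by
      have := (((hasDerivAt_pow 2 s).const_mul (1 : ℝ)).div_const 2)
      convert! this using 1
      simp
    have := h1.ofReal_comp.add (h2.ofReal_comp.mul_const I)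
    convert! this using 1
  set F : ℝ → ℂ := fun s => ((Real.exp (-ξ * s) : ℝ) : ℂ) * (p s) ^ ((a : ℂ) + 1) with hF
  have hnorm : ∀ s : ℝ, ‖F s‖ = Real.exp (-ξ * s) * ‖p s‖ ^ (a + 1) := by
    intro s
    have : ((a : ℂ) + 1) = ((a + 1 : ℝ) : ℂ) := by push_cast; rfl
    rw [hF]
    simp only
    rw [norm_mul, norm_real, Real.norm_of_nonneg (Real.exp_pos _).le, this, norm_cpow_real]
  have hpc : Continuous p := continuous_iff_continuousAt.2 fun s => (hp' s).continuousAt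
  have hF0 : F 0 = 0 := by
    have : ‖F 0‖ = 0 := by
      rw [hnorm]
      have : p 0 = 0 := by simp [hp]
      rw [this, norm_zero, Real.zero_rpow (by linarith), mul_zero]
    exact norm_eq_zero.1 this
  have hnc : Continuous fun s : ℝ => Real.exp (-ξ * s) * ‖p s‖ ^ (a + 1) := by
    refine Continuous.mul (by fun_prop) ?_
    exact hpc.norm.rpow_const fun s => Or.inr (by linarith)
  have hcont : ContinuousWithinAt F (Ici 0) 0 := by
    refine ContinuousAt.continuousWithinAt ?_
    rw [ContinuousAt, hF0, tendsto_zero_iff_norm_tendsto_zero]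
    have := hnc.tendsto 0
    rw [← hnorm, hF0, norm_zero] at this
    exact this.congr fun s => (hnorm s).symm
  have hderiv : ∀ s ∈ Ioi (0 : ℝ), HasDerivAt F
      (-(ξ * I / 2) * (((Real.exp (-ξ * s) * s ^ 2 : ℝ) : ℂ) * hankelKernel a 1 1 s)
        + (-ξ + (a + 1) * I) * (((Real.exp (-ξ * s) * s ^ 1 : ℝ) : ℂ) * hankelKernel a 1 1 s)
        + (a + 1) * (((Real.exp (-ξ * s) * s ^ 0 : ℝ) : ℂ) * hankelKernel a 1 1 s)) s := by
    intro s hs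
    have hne : p s ≠ 0 := slitPlane_ne_zero (hslit s hs)
    have h1 : HasDerivAt (fun s : ℝ => Real.exp (-ξ * s)) (Real.exp (-ξ * s) * (-ξ)) s := by
      have := ((hasDerivAt_id s).const_mul (-ξ)).exp
      simpa using this
    have h2 : HasDerivAt (fun s : ℝ => (p s) ^ ((a : ℂ) + 1))
        (((a : ℂ) + 1) * (p s) ^ ((a : ℂ) + 1 - 1) * (1 + s * I)) s := by
      have := (hasDerivAt_id (p s)).cpow_const (c := (a : ℂ) + 1) (hslit s hs)
      have h3 := HasDerivAt.scomp s this (hp' s)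
      simp only [mul_one, smul_eq_mul, id] at h3
      convert! h3 using 1
      ring
    have h3 := h1.ofReal_comp.mul h2
    convert! h3 using 1
    have hK : hankelKernel a 1 1 s = (p s) ^ (a : ℂ) := rfl
    have e1 : (p s) ^ ((a : ℂ) + 1) = (p s) ^ (a : ℂ) * p s := by
      rw [cpow_add _ _ hne, cpow_one]
    rw [add_sub_cancel_right, e1, hK]
    have e2 : p s = s + s ^ 2 / 2 * I := by simp [hp]
    rw [show (p s) ^ (a : ℂ) * p s = (p s) ^ (a : ℂ) * (s + s ^ 2 / 2 * I) from by rw [e2]]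
    push_cast
    ring
  have hi := fun k => integrable_hankel ha hξ k
  have hint := (((hi 2).const_mul (-(ξ * I / 2))).add
    ((hi 1).const_mul (-(ξ : ℂ) + (a + 1) * I))).add ((hi 0).const_mul ((a : ℂ) + 1))
  have hlim : Tendsto F atTop (𝓝 0) := by
    rw [tendsto_zero_iff_norm_tendsto_zero]
    have hb : Tendsto (fun s : ℝ => 2 * (s ^ (2 * (a + 1)) * Real.exp (-ξ * s))) atTop (𝓝 0) := by
      simpa using (tendsto_rpow_mul_exp_neg_mul_atTop_nhds_zero (2 * (a + 1)) ξ hξ).const_mul 2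
    refine squeeze_zero' (Eventually.of_forall fun s => norm_nonneg _) ?_ hb
    filter_upwards [eventually_ge_atTop (2 : ℝ)] with s hs
    rw [hnorm]
    have hs0 : 0 < s := by linarith
    have h1 : ‖p s‖ ≤ s ^ 2 := by
      refine (norm_le_abs_re_add_abs_im _).trans ?_
      have hre : (p s).re = s := by simp [hp, sq]
      have him : (p s).im = s ^ 2 / 2 := by simp [hp, sq]
      rw [hre, him, abs_of_nonneg hs0.le, abs_of_nonneg (by positivity)]
      nlinarith
    have h2 : ‖p s‖ ^ (a + 1) ≤ s ^ (2 * (a + 1)) := by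
      refine (Real.rpow_le_rpow (norm_nonneg _) h1 (by linarith)).trans (le_of_eq ?_)
      rw [← Real.rpow_natCast, ← Real.rpow_mul hs0.le]; norm_num
    have h3 := mul_le_mul_of_nonneg_left h2 (Real.exp_pos (-ξ * s)).le
    have h4 : 0 ≤ s ^ (2 * (a + 1)) * Real.exp (-ξ * s) := by positivity
    linarith
  have key := integral_Ioi_of_hasDerivAt_of_tendsto hcont hderiv hint hlim
  rw [hF0, sub_zero, integral_add, integral_add, integral_const_mul, integral_const_mul,
    integral_const_mul] at key
  · have e : ∀ k, (∫ s in Ioi (0 : ℝ), ((Real.exp (-ξ * s) * s ^ k : ℝ) : ℂ)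
        * hankelKernel a 1 1 s) = hankelMoment a k ξ := fun _ => rfl
    rw [e 2, e 1, e 0] at key
    linear_combination -key
  · exact (hi 2).const_mul (-(ξ * I / 2))
  · exact (hi 1).const_mul (-(ξ : ℂ) + (a + 1) * I)
  · exact ((hi 2).const_mul (-(ξ * I / 2))).add ((hi 1).const_mul (-(ξ : ℂ) + (a + 1) * I))
  · exact (hi 0).const_mul ((a : ℂ) + 1)

/-- The substitution `r = ξ s` in `L₀`. The choice `c = ξ` gives `x = 1`, `y = 1 / ξ`, suited to
`ξ → ∞`; the choice `c = ξ²` gives `x = ξ`, `y = 1`, suited to `ξ → 0`. -/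
theorem rpow_mul_hankelMoment {a c x y ξ : ℝ} (hξ : 0 < ξ) (hc : 0 < c) (hx : x * ξ = c)
    (hy : y * ξ ^ 2 = c) :
    ((c ^ a * ξ : ℝ) : ℂ) * hankelMoment a 0 ξ =
      ∫ r in Ioi (0 : ℝ), ((Real.exp (-1 * r) * r ^ 0 : ℝ) : ℂ) * hankelKernel a x y r := by
  have h := integral_comp_mul_left_Ioi
    (fun r : ℝ => ((Real.exp (-1 * r) * r ^ 0 : ℝ) : ℂ) * hankelKernel a x y r) 0 hξ
  rw [mul_zero] at h
  have e : ∀ s ∈ Ioi (0 : ℝ),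
      ((Real.exp (-1 * (ξ * s)) * (ξ * s) ^ 0 : ℝ) : ℂ) * hankelKernel a x y (ξ * s) =
      ((c ^ a : ℝ) : ℂ) * (((Real.exp (-ξ * s) * s ^ 0 : ℝ) : ℂ) * hankelKernel a 1 1 s) := by
    intro s hs
    have hz := slitPlane_ne_zero
      (hankelBase_mem_slitPlane zero_le_one zero_le_one (Or.inl rfl) (mem_Ioi.1 hs))
    have hk : hankelKernel a x y (ξ * s) = ((c ^ a : ℝ) : ℂ) * hankelKernel a 1 1 s := by
      rw [hankelKernel, hankelKernel, ← real_mul_cpow hc hz]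
      congr 1
      have h1 : x * (ξ * s) = c * (1 * s) := by rw [← hx]; ring
      have h2 : y * (ξ * s) ^ 2 / 2 = c * (1 * s ^ 2 / 2) := by rw [← hy]; ring
      rw [h1, h2]
      push_cast
      ring
    rw [hk, show -1 * (ξ * s) = -ξ * s by ring]
    simp only [pow_zero, mul_one]
    ring
  rw [setIntegral_congr_fun measurableSet_Ioi e, integral_const_mul] at h
  rw [hankelMoment, ofReal_mul, mul_comm ((c ^ a : ℝ) : ℂ), mul_assoc, h]
  rw [real_smul, ← mul_assoc, ← ofReal_mul, mul_inv_cancel₀ hξ.ne', ofReal_one, one_mul]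

theorem hankelKernel_tendsto {a x₀ y₀ r : ℝ} {l : Filter ℝ} {x y : ℝ → ℝ} (hr : 0 < r)
    (hx₀ : 0 ≤ x₀) (hy₀ : 0 ≤ y₀) (hxy : x₀ = 1 ∨ y₀ = 1)
    (hx : Tendsto x l (𝓝 x₀)) (hy : Tendsto y l (𝓝 y₀)) :
    Tendsto (fun ξ => hankelKernel a (x ξ) (y ξ) r) l (𝓝 (hankelKernel a x₀ y₀ r)) := by
  refine (continuousAt_cpow_const (hankelBase_mem_slitPlane hx₀ hy₀ hxy hr)).tendsto.comp ?_
  refine Tendsto.add ?_ (Tendsto.mul_const _ ?_)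
  · exact (continuous_ofReal.tendsto _).comp (hx.mul_const r)
  · exact (continuous_ofReal.tendsto _).comp ((hy.mul_const (r ^ 2)).div_const 2)

theorem integral_hankel_tendsto {a x₀ y₀ : ℝ} (ha : |a| < 1 / 2) {l : Filter ℝ}
    [l.IsCountablyGenerated] {x y : ℝ → ℝ} (hx₀ : 0 ≤ x₀) (hy₀ : 0 ≤ y₀) (hxy₀ : x₀ = 1 ∨ y₀ = 1)
    (hxy : ∀ᶠ ξ in l, 0 ≤ x ξ ∧ 0 ≤ y ξ ∧ x ξ ≤ 1 ∧ y ξ ≤ 1 ∧ (x ξ = 1 ∨ y ξ = 1))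
    (hx : Tendsto x l (𝓝 x₀)) (hy : Tendsto y l (𝓝 y₀)) :
    Tendsto (fun ξ => ∫ r in Ioi (0 : ℝ),
        ((Real.exp (-1 * r) * r ^ 0 : ℝ) : ℂ) * hankelKernel a (x ξ) (y ξ) r) l
      (𝓝 (∫ r in Ioi (0 : ℝ), ((Real.exp (-1 * r) * r ^ 0 : ℝ) : ℂ) * hankelKernel a x₀ y₀ r)) := by
  refine tendsto_integral_filter_of_dominated_convergence _ ?_ ?_
    (integrableOn_hankelBound ha one_pos 0) ?_
  · filter_upwards [hxy] with ξ h
    exact aestronglyMeasurable_hankel h.1 h.2.1 h.2.2.2.2 0 1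
  · filter_upwards [hxy] with ξ h
    filter_upwards [ae_restrict_mem measurableSet_Ioi] with s hs
    exact norm_hankelIntegrand_le ha h.1 h.2.1 h.2.2.1 h.2.2.2.1 h.2.2.2.2 le_rfl hs 0
  · filter_upwards [ae_restrict_mem measurableSet_Ioi] with s hs
    exact (hankelKernel_tendsto hs hx₀ hy₀ hxy₀ hx hy).const_mul _

/-- `ξ^{a+1} L₀(ξ) → Γ(a+1)` at infinity. -/
theorem hankelMoment_tendsto_atTop {a : ℝ} (ha : |a| < 1 / 2) :
    Tendsto (fun ξ : ℝ => ((ξ ^ (a + 1) : ℝ) : ℂ) * hankelMoment a 0 ξ) atTop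
      (𝓝 (Real.Gamma (a + 1) : ℂ)) := by
  obtain ⟨ha1, ha2⟩ := abs_lt.1 ha
  have h := integral_hankel_tendsto (a := a) (x := fun _ => 1) (y := fun ξ => ξ⁻¹) (l := atTop) ha
    zero_le_one le_rfl (Or.inl rfl) ?_ tendsto_const_nhds tendsto_inv_atTop_zero
  · have e : (∫ r in Ioi (0 : ℝ), ((Real.exp (-1 * r) * r ^ 0 : ℝ) : ℂ) * hankelKernel a 1 0 r)
        = (Real.Gamma (a + 1) : ℂ) := by
      rw [Real.Gamma_eq_integral (by linarith), ← integral_complex_ofReal]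
      refine setIntegral_congr_fun measurableSet_Ioi fun r hr => ?_
      have hr' : (0 : ℝ) < r := hr
      simp only [hankelKernel]
      rw [add_sub_cancel_right, ofReal_mul (Real.exp (-r)), ofReal_cpow hr'.le]
      simp
    rw [e] at h
    refine h.congr' ?_
    filter_upwards [eventually_gt_atTop (0 : ℝ)] with ξ hξ
    rw [← rpow_mul_hankelMoment hξ hξ (one_mul ξ) (by field_simp), Real.rpow_add hξ, Real.rpow_one]
  · filter_upwards [eventually_ge_atTop (1 : ℝ)] with ξ hξ
    exact ⟨zero_le_one, by positivity, le_rfl, inv_le_one_of_one_le₀ hξ, Or.inl rfl⟩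

/-- Near `0`, `ξ^{2a+1} L₀(ξ)` converges to a real multiple of `i^a`. -/
theorem hankelMoment_tendsto_zero {a : ℝ} (ha : |a| < 1 / 2) :
    ∃ C : ℝ, Tendsto (fun ξ : ℝ => ((ξ ^ (2 * a + 1) : ℝ) : ℂ) * hankelMoment a 0 ξ) (𝓝[>] 0)
      (𝓝 ((C : ℂ) * exp ((a * Real.pi / 2 : ℝ) * I))) := by
  have h := integral_hankel_tendsto (a := a) (x := fun ξ => ξ) (y := fun _ => 1) (l := 𝓝[>] 0) ha
    le_rfl zero_le_one (Or.inr rfl) ?_ (tendsto_id.mono_left nhdsWithin_le_nhds) tendsto_const_nhds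
  · refine ⟨∫ r in Ioi (0 : ℝ), Real.exp (-r) * (r ^ 2 / 2) ^ a, ?_⟩
    have e : (∫ r in Ioi (0 : ℝ), ((Real.exp (-1 * r) * r ^ 0 : ℝ) : ℂ) * hankelKernel a 0 1 r)
        = ((∫ r in Ioi (0 : ℝ), Real.exp (-r) * (r ^ 2 / 2) ^ a : ℝ) : ℂ)
          * exp ((a * Real.pi / 2 : ℝ) * I) := by
      rw [← integral_complex_ofReal, ← integral_mul_const]
      refine setIntegral_congr_fun measurableSet_Ioi fun r hr => ?_
      have hr' : (0 : ℝ) < r := hr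
      simp only [hankelKernel]
      rw [zero_mul, ofReal_zero, zero_add, real_mul_cpow (by positivity) I_ne_zero,
        cpow_def_of_ne_zero I_ne_zero, log_I]
      push_cast
      simp only [neg_one_mul, pow_zero, mul_one, one_mul]
      rw [← mul_assoc]
      congr 2
      ring
    rw [e] at h
    refine h.congr' ?_
    filter_upwards [self_mem_nhdsWithin] with ξ hξ
    have hξ' : (0 : ℝ) < ξ := hξ
    rw [← rpow_mul_hankelMoment (c := ξ ^ 2) hξ' (by positivity) (by ring) (by ring),
      Real.rpow_add hξ', Real.rpow_one, ← Real.rpow_natCast, ← Real.rpow_mul hξ'.le]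
    norm_num
  · have : Ioc (0 : ℝ) 1 ∈ 𝓝[>] (0 : ℝ) := Ioc_mem_nhdsGT one_pos
    filter_upwards [this] with ξ hξ
    exact ⟨hξ.1.le, zero_le_one, hξ.2, le_rfl, Or.inr rfl⟩

end CanonicalAiry

/-! ### Phase and zeroes of solutions of `w'' + (1 + Q / ξ²) w = 0` -/

namespace CanonicalAiry
open Set Topology

/-- `w` solves the normal form `w'' + (1 + Q / ξ²) w = 0` on the half-line, `w₁` being `w'`. -/
structure IsWave (Q : ℝ) (w w₁ : ℝ → ℝ) : Prop where
  hasDerivAt : ∀ ξ, 0 < ξ → HasDerivAt w (w₁ ξ) ξ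
  hasDerivAt' : ∀ ξ, 0 < ξ → HasDerivAt w₁ (-(1 + Q / ξ ^ 2) * w ξ) ξ

theorem eq_of_hasDerivAt_zero {f : ℝ → ℝ} (h : ∀ ξ, 0 < ξ → HasDerivAt f 0 ξ) {x y : ℝ}
    (hx : 0 < x) (hy : 0 < y) : f x = f y :=
  isOpen_Ioi.is_const_of_deriv_eq_zero isPreconnected_Ioi
    (fun ξ hξ => (h ξ hξ).differentiableAt.differentiableWithinAt) (fun ξ hξ => (h ξ hξ).deriv)
    (mem_Ioi.2 hx) (mem_Ioi.2 hy)

/-- Polar coordinates `w = R sin θ`, `w' = R cos θ`. The phase is defined as the integral of its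
derivative `1 + (Q / ξ²) (w / R)²`, so that no branch of the argument has to be followed. -/
theorem IsWave.exists_phase {Q : ℝ} {w w₁ : ℝ → ℝ} (hw : IsWave Q w w₁)
    (hne : ∀ ξ, 0 < ξ → w ξ = 0 → w₁ ξ ≠ 0) :
    ∃ θ R : ℝ → ℝ, ∀ ξ, 0 < ξ →
      HasDerivAt θ (1 + Q / ξ ^ 2 * Real.sin (θ ξ) ^ 2) ξ ∧ R ξ ≠ 0 ∧
      w ξ = R ξ * Real.sin (θ ξ) ∧ w₁ ξ = R ξ * Real.cos (θ ξ) := by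
  set n : ℝ → ℝ := fun ξ => w ξ ^ 2 + w₁ ξ ^ 2 with hn
  have hnpos : ∀ ξ, 0 < ξ → 0 < n ξ := by
    intro ξ hξ
    by_cases h : w ξ = 0
    · have := hne ξ hξ h
      have : 0 < w₁ ξ ^ 2 := by positivity
      simp only [hn]; nlinarith [sq_nonneg (w ξ)]
    · have : 0 < w ξ ^ 2 := by positivity
      simp only [hn]; nlinarith [sq_nonneg (w₁ ξ)]
  set R : ℝ → ℝ := fun ξ => √(n ξ) with hR
  have hRpos : ∀ ξ, 0 < ξ → 0 < R ξ := fun ξ hξ => Real.sqrt_pos.2 (hnpos ξ hξ)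
  have hRsq : ∀ ξ, 0 < ξ → R ξ ^ 2 = w ξ ^ 2 + w₁ ξ ^ 2 :=
    fun ξ hξ => Real.sq_sqrt (hnpos ξ hξ).le
  have hR' : ∀ ξ, 0 < ξ → HasDerivAt R (-(Q / ξ ^ 2) * w ξ * w₁ ξ / R ξ) ξ := by
    intro ξ hξ
    have h1 := ((hw.hasDerivAt ξ hξ).pow 2).add ((hw.hasDerivAt' ξ hξ).pow 2)
    have h2 := h1.sqrt (hnpos ξ hξ).ne'
    convert! h2 using 1
    simp only [Pi.add_apply, Pi.pow_apply]
    change _ = _ / (2 * R ξ)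
    have := (hRpos ξ hξ).ne'
    field_simp
    ring
  set q : ℝ → ℝ := fun ξ => 1 + Q / ξ ^ 2 * (w ξ / R ξ) ^ 2 with hq
  have hqc : ∀ ξ, 0 < ξ → ContinuousAt q ξ := by
    intro ξ hξ
    have h1 := (hw.hasDerivAt ξ hξ).continuousAt
    have h2 := (hR' ξ hξ).continuousAt
    have h3 := (hRpos ξ hξ).ne'
    have h4 : ξ ^ 2 ≠ 0 := by positivity
    exact continuousAt_const.add
      ((continuousAt_const.div (continuousAt_id.pow 2) h4).mul ((h1.div h2 h3).pow 2))
  set z : ℂ := ⟨w₁ 1, w 1⟩ with hz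
  set θ : ℝ → ℝ := fun ξ => z.arg + ∫ s in (1 : ℝ)..ξ, q s with hθ
  have hθ' : ∀ ξ, 0 < ξ → HasDerivAt θ (q ξ) ξ := by
    intro ξ hξ
    have hcon : ContinuousOn q (Ioi 0) := fun x hx => (hqc x hx).continuousWithinAt
    refine (intervalIntegral.integral_hasDerivAt_right ?_ ?_ (hqc ξ hξ)).const_add _
    · refine (hcon.mono ?_).intervalIntegrable
      intro x hx
      exact lt_of_lt_of_le (lt_min one_pos hξ) hx.1
    · exact hcon.stronglyMeasurableAtFilter isOpen_Ioi ξ hξ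
  have hS : ∀ ξ, 0 < ξ → HasDerivAt (fun ξ => w ξ / R ξ) (q ξ * (w₁ ξ / R ξ)) ξ := by
    intro ξ hξ
    have h := (hw.hasDerivAt ξ hξ).div (hR' ξ hξ) (hRpos ξ hξ).ne'
    convert! h using 1
    have h3 := (hRpos ξ hξ).ne'
    simp only [hq]
    field_simp
    ring
  have hC : ∀ ξ, 0 < ξ → HasDerivAt (fun ξ => w₁ ξ / R ξ) (-q ξ * (w ξ / R ξ)) ξ := by
    intro ξ hξ
    have h := (hw.hasDerivAt' ξ hξ).div (hR' ξ hξ) (hRpos ξ hξ).ne'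
    convert! h using 1
    have h3 := (hRpos ξ hξ).ne'
    have h4 := hRsq ξ hξ
    simp only [hq]
    field_simp
    linear_combination (w ξ * Q) * h4
  -- In the frame rotating with angle `θ`, the unit vector `(w₁ / R, w / R)` is constant.
  have hA := fun (ξ : ℝ) (hξ : 0 < ξ) =>
    ((hS ξ hξ).mul (hθ' ξ hξ).cos).sub ((hC ξ hξ).mul (hθ' ξ hξ).sin)
  have hB := fun (ξ : ℝ) (hξ : 0 < ξ) =>
    ((hS ξ hξ).mul (hθ' ξ hξ).sin).add ((hC ξ hξ).mul (hθ' ξ hξ).cos)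
  have hA0 := fun (ξ : ℝ) (hξ : 0 < ξ) => eq_of_hasDerivAt_zero
    (fun x hx => (hA x hx).congr_deriv (by ring)) hξ one_pos
  have hB0 := fun (ξ : ℝ) (hξ : 0 < ξ) => eq_of_hasDerivAt_zero
    (fun x hx => (hB x hx).congr_deriv (by ring)) hξ one_pos
  simp only [Pi.sub_apply, Pi.add_apply, Pi.mul_apply] at hA0 hB0
  have hθ1 : θ 1 = z.arg := by simp [hθ]
  have hzn : ‖z‖ = R 1 := by
    rw [Complex.norm_def, Complex.normSq_apply, hR]
    simp only [hn, hz]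
    congr 1; ring
  have hz0 : z ≠ 0 := by
    rw [← norm_pos_iff, hzn]; exact hRpos 1 one_pos
  have hs1 : Real.sin (θ 1) = w 1 / R 1 := by rw [hθ1, Complex.sin_arg, hzn]
  have hc1 : Real.cos (θ 1) = w₁ 1 / R 1 := by rw [hθ1, Complex.cos_arg hz0, hzn]
  have hsc : ∀ ξ, 0 < ξ → w ξ / R ξ = Real.sin (θ ξ) ∧ w₁ ξ / R ξ = Real.cos (θ ξ) := by
    intro ξ hξ
    have ha := hA0 ξ hξ
    have hb := hB0 ξ hξ
    rw [hs1, hc1] at ha hb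
    have h1 : w 1 / R 1 * (w 1 / R 1) + w₁ 1 / R 1 * (w₁ 1 / R 1) = 1 := by
      rw [← hs1, ← hc1]; nlinarith [Real.sin_sq_add_cos_sq (θ 1)]
    have h2 := Real.sin_sq_add_cos_sq (θ ξ)
    rw [h1] at hb
    rw [mul_comm (w₁ 1 / R 1), sub_self] at ha
    constructor
    · linear_combination Real.cos (θ ξ) * ha + Real.sin (θ ξ) * hb - w ξ / R ξ * h2
    · linear_combination -Real.sin (θ ξ) * ha + Real.cos (θ ξ) * hb - w₁ ξ / R ξ * h2
  refine ⟨θ, R, fun ξ hξ => ⟨?_, (hRpos ξ hξ).ne', ?_, ?_⟩⟩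
  · rw [← (hsc ξ hξ).1]; exact hθ' ξ hξ
  · rw [← (hsc ξ hξ).1]; field_simp [(hRpos ξ hξ).ne']
  · rw [← (hsc ξ hξ).2]; field_simp [(hRpos ξ hξ).ne']

/-- Since `|θ' - 1| ≤ |Q| / ξ²`, adding or subtracting `|Q| / ξ` makes `θ - ξ` monotone. -/
theorem phase_bounds {Q : ℝ} {θ : ℝ → ℝ}
    (hθ : ∀ ξ, 0 < ξ → HasDerivAt θ (1 + Q / ξ ^ 2 * Real.sin (θ ξ) ^ 2) ξ) :
    MonotoneOn (fun ξ => θ ξ - ξ - |Q| / ξ) (Ioi 0) ∧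
      AntitoneOn (fun ξ => θ ξ - ξ + |Q| / ξ) (Ioi 0) := by
  have hd : ∀ ξ : ℝ, 0 < ξ → HasDerivAt (fun ξ : ℝ => |Q| / ξ) (-|Q| / ξ ^ 2) ξ := by
    intro ξ hξ
    have := (hasDerivAt_inv hξ.ne').const_mul |Q|
    simp only [div_eq_mul_inv]
    convert! this using 1
    ring
  have h1 : ∀ ξ : ℝ, 0 < ξ → HasDerivAt (fun ξ => θ ξ - ξ - |Q| / ξ)
      ((Q * Real.sin (θ ξ) ^ 2 + |Q|) / ξ ^ 2) ξ := fun ξ hξ =>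
    (((hθ ξ hξ).sub (hasDerivAt_id ξ)).sub (hd ξ hξ)).congr_deriv (by ring)
  have h2 : ∀ ξ : ℝ, 0 < ξ → HasDerivAt (fun ξ => θ ξ - ξ + |Q| / ξ)
      ((Q * Real.sin (θ ξ) ^ 2 - |Q|) / ξ ^ 2) ξ := fun ξ hξ =>
    (((hθ ξ hξ).sub (hasDerivAt_id ξ)).add (hd ξ hξ)).congr_deriv (by ring)
  have hb : ∀ x : ℝ, |Q * Real.sin x ^ 2| ≤ |Q| := by
    intro x
    rw [abs_mul, abs_of_nonneg (sq_nonneg (Real.sin x))]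
    exact mul_le_of_le_one_right (abs_nonneg Q) (Real.sin_sq_le_one x)
  constructor
  · refine monotoneOn_of_deriv_nonneg (convex_Ioi 0)
      (fun ξ hξ => (h1 ξ hξ).continuousAt.continuousWithinAt)
      (fun ξ hξ => (h1 ξ (interior_subset hξ)).differentiableAt.differentiableWithinAt) ?_
    intro ξ hξ
    rw [(h1 ξ (interior_subset hξ)).deriv]
    exact div_nonneg (by linarith [neg_le_of_abs_le (hb (θ ξ))]) (sq_nonneg _)
  · refine antitoneOn_of_deriv_nonpos (convex_Ioi 0)
      (fun ξ hξ => (h2 ξ hξ).continuousAt.continuousWithinAt)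
      (fun ξ hξ => (h2 ξ (interior_subset hξ)).differentiableAt.differentiableWithinAt) ?_
    intro ξ hξ
    rw [(h2 ξ (interior_subset hξ)).deriv]
    exact div_nonpos_of_nonpos_of_nonneg (by linarith [le_of_abs_le (hb (θ ξ))]) (sq_nonneg _)

/-- The limit `L` of `θ - ξ`, with the rate of convergence. -/
theorem exists_phase_limit {Q : ℝ} {θ : ℝ → ℝ}
    (hθ : ∀ ξ, 0 < ξ → HasDerivAt θ (1 + Q / ξ ^ 2 * Real.sin (θ ξ) ^ 2) ξ) :
    ∃ L, ∀ ξ, 0 < ξ → |θ ξ - ξ - L| ≤ |Q| / ξ := by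
  obtain ⟨hm, ha⟩ := phase_bounds hθ
  have hle : ∀ x y : ℝ, 0 < x → 0 < y → θ x - x - |Q| / x ≤ θ y - y + |Q| / y := by
    intro x y hx hy
    have hx' : 0 ≤ |Q| / x := by positivity
    have hy' : 0 ≤ |Q| / y := by positivity
    rcases le_total x y with h | h
    · have := hm (mem_Ioi.2 hx) (mem_Ioi.2 hy) h
      simp only at this
      linarith
    · have := ha (mem_Ioi.2 hy) (mem_Ioi.2 hx) h
      simp only at this
      linarith
  refine ⟨sInf ((fun ξ => θ ξ - ξ + |Q| / ξ) '' Ioi 0), fun ξ hξ => ?_⟩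
  have h1 : sInf ((fun ξ => θ ξ - ξ + |Q| / ξ) '' Ioi 0) ≤ θ ξ - ξ + |Q| / ξ := by
    refine csInf_le ⟨θ 1 - 1 - |Q| / 1, ?_⟩ ⟨ξ, hξ, rfl⟩
    rintro _ ⟨y, hy, rfl⟩
    exact hle 1 y one_pos hy
  have h2 : θ ξ - ξ - |Q| / ξ ≤ sInf ((fun ξ => θ ξ - ξ + |Q| / ξ) '' Ioi 0) := by
    refine le_csInf ⟨_, 1, mem_Ioi.2 one_pos, rfl⟩ ?_
    rintro _ ⟨y, hy, rfl⟩
    exact hle ξ y hξ hy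
  rw [abs_le]
  constructor <;> linarith

theorem phase_takes_value {Q : ℝ} {θ : ℝ → ℝ}
    (hθ : ∀ ξ, 0 < ξ → HasDerivAt θ (1 + Q / ξ ^ 2 * Real.sin (θ ξ) ^ 2) ξ) {M b : ℝ} (hM : 0 < M)
    (hb : θ M ≤ b) : ∃ ξ, M ≤ ξ ∧ θ ξ = b := by
  obtain ⟨L, hL⟩ := exists_phase_limit hθ
  set y : ℝ := max M (b - L + |Q| / M) with hy
  have hMy : M ≤ y := le_max_left _ _
  have hyp : 0 < y := hM.trans_le hMy
  have h1 := (abs_le.1 (hL y hyp)).1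
  have h2 : |Q| / y ≤ |Q| / M := by gcongr
  have h3 : b - L + |Q| / M ≤ y := le_max_right _ _
  have hc : ContinuousOn θ (Icc M y) := fun ξ hξ =>
    (hθ ξ (hM.trans_le hξ.1)).continuousAt.continuousWithinAt
  obtain ⟨ξ, hξ, he⟩ := intermediate_value_Icc hMy hc ⟨hb, (by linarith : b ≤ θ y)⟩
  exact ⟨ξ, hξ.1, he⟩

/-- A wave whose zeroes are asymptotically those of `sin (ξ + φ)` has phase `ξ + φ + O(1/ξ)`. The
phase is chosen so that no multiple of `π` is left over, which may make `R` negative. -/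
theorem IsWave.exists_normalized_phase {Q φ : ℝ} {w w₁ : ℝ → ℝ} (hw : IsWave Q w w₁)
    (hne : ∀ ξ, 0 < ξ → w ξ = 0 → w₁ ξ ≠ 0)
    (hφ : Tendsto (fun ξ => Real.sin (ξ + φ)) (atTop ⊓ 𝓟 {ξ | w ξ = 0}) (𝓝 0)) :
    ∃ θ R : ℝ → ℝ, ∀ ξ, 0 < ξ →
      HasDerivAt θ (1 + Q / ξ ^ 2 * Real.sin (θ ξ) ^ 2) ξ ∧ R ξ ≠ 0 ∧
      w ξ = R ξ * Real.sin (θ ξ) ∧ w₁ ξ = R ξ * Real.cos (θ ξ) ∧ |θ ξ - ξ - φ| ≤ |Q| / ξ := by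
  obtain ⟨θ, R, h⟩ := hw.exists_phase hne
  have hθ := fun ξ hξ => (h ξ hξ).1
  obtain ⟨L, hL⟩ := exists_phase_limit hθ
  have hfreq : ∃ᶠ ξ in atTop, w ξ = 0 := by
    rw [frequently_atTop]
    intro M
    obtain ⟨ξ, hξ, he⟩ := phase_takes_value hθ (M := max M 1)
      (b := ⌈θ (max M 1) / Real.pi⌉ * Real.pi) (by positivity)
      ((div_le_iff₀ Real.pi_pos).1 (Int.le_ceil _))
    refine ⟨ξ, (le_max_left _ _).trans hξ, ?_⟩
    rw [(h ξ (one_pos.trans_le ((le_max_right M 1).trans hξ))).2.2.1, he, Real.sin_int_mul_pi,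
      mul_zero]
  have hnb : (atTop ⊓ 𝓟 {ξ | w ξ = 0}).NeBot := frequently_mem_iff_neBot.1 hfreq
  have he : Tendsto (fun ξ => θ ξ - ξ - L) (atTop ⊓ 𝓟 {ξ | w ξ = 0}) (𝓝 0) := by
    refine Tendsto.mono_left ?_ inf_le_left
    refine squeeze_zero_norm' ?_ (tendsto_const_nhds.div_atTop tendsto_id :
      Tendsto (fun ξ : ℝ => |Q| / ξ) atTop (𝓝 0))
    filter_upwards [eventually_gt_atTop 0] with ξ hξ using hL ξ hξ
  -- Along the zeroes, `θ ∈ π ℤ` and `ξ = θ - L + o(1)`, so `|sin (ξ + φ)| → |sin (φ - L)|`.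
  have hs : |Real.sin (φ - L)| = 0 := by
    have h1 : Tendsto (fun ξ => |Real.sin (φ - L - (θ ξ - ξ - L))|) (atTop ⊓ 𝓟 {ξ | w ξ = 0})
        (𝓝 |Real.sin (φ - L - 0)|) :=
      ((Real.continuous_sin.tendsto _).comp (he.const_sub _)).abs
    rw [sub_zero] at h1
    refine tendsto_nhds_unique h1 ?_
    have h2 := hφ.abs
    rw [abs_zero] at h2
    refine h2.congr' ?_
    have hpos : ∀ᶠ ξ : ℝ in atTop ⊓ 𝓟 {ξ | w ξ = 0}, 0 < ξ :=
      (eventually_gt_atTop (0 : ℝ)).filter_mono inf_le_left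
    have hzero : ∀ᶠ ξ : ℝ in atTop ⊓ 𝓟 {ξ | w ξ = 0}, w ξ = 0 :=
      (mem_inf_of_right (mem_principal_self _) : _)
    filter_upwards [hpos, hzero] with ξ hξ hz
    have hsin : Real.sin (θ ξ) = 0 := by
      have := (h ξ hξ).2.2.1
      rw [hz] at this
      exact (mul_eq_zero.1 this.symm).resolve_left (h ξ hξ).2.1
    have hcos : |Real.cos (θ ξ)| = 1 := by
      rw [← sq_eq_sq₀ (abs_nonneg _) zero_le_one, sq_abs]
      nlinarith [Real.sin_sq_add_cos_sq (θ ξ)]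
    rw [show ξ + φ = θ ξ + (φ - L - (θ ξ - ξ - L)) by ring, Real.sin_add, hsin, zero_mul, zero_add,
      abs_mul, hcos, one_mul]
  obtain ⟨m, hm⟩ := Real.sin_eq_zero_iff.1 (abs_eq_zero.1 hs)
  have hsinm : ∀ x : ℝ, Real.sin x = Real.cos (m * Real.pi) * Real.sin (x + m * Real.pi) := by
    intro x
    have h1 := Real.sin_sq_add_cos_sq (m * Real.pi)
    rw [Real.sin_add, Real.sin_int_mul_pi] at *
    linear_combination -Real.sin x * h1
  have hcosm : ∀ x : ℝ, Real.cos x = Real.cos (m * Real.pi) * Real.cos (x + m * Real.pi) := by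
    intro x
    have h1 := Real.sin_sq_add_cos_sq (m * Real.pi)
    rw [Real.cos_add, Real.sin_int_mul_pi] at *
    linear_combination -Real.cos x * h1
  have hcm : Real.cos (m * Real.pi) ≠ 0 := by
    intro h0
    have h1 := Real.sin_sq_add_cos_sq (m * Real.pi)
    rw [Real.sin_int_mul_pi, h0] at h1
    norm_num at h1
  refine ⟨fun ξ => θ ξ + m * Real.pi, fun ξ => R ξ * Real.cos (m * Real.pi), fun ξ hξ =>
    ⟨?_, mul_ne_zero (h ξ hξ).2.1 hcm, ?_, ?_, ?_⟩⟩
  · convert! (hθ ξ hξ).add_const (m * Real.pi) using 1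
    rw [Real.sin_add, Real.sin_int_mul_pi]
    have h1 := Real.sin_sq_add_cos_sq (m * Real.pi)
    rw [Real.sin_int_mul_pi] at h1
    linear_combination (Q / ξ ^ 2 * Real.sin (θ ξ) ^ 2) * h1
  · rw [(h ξ hξ).2.2.1, hsinm (θ ξ)]; ring
  · rw [(h ξ hξ).2.2.2, hcosm (θ ξ)]; ring
  · rw [hm]
    have := hL ξ hξ
    rw [show θ ξ + (φ - L) - ξ - φ = θ ξ - ξ - L by ring]
    exact this

/-- Enumeration of the zeroes, up to the integer `N`. The `j`-th zero is the point where the phase,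
which is strictly increasing on `[1, ∞)`, equals `(N + j) π`. -/
theorem IsWave.exists_zeros {Q φ : ℝ} {w w₁ : ℝ → ℝ} (hw : IsWave Q w w₁) (hQ : |Q| < 1)
    (hne : ∀ ξ, 0 < ξ → w ξ = 0 → w₁ ξ ≠ 0) (h01 : ∀ ξ, 0 < ξ → ξ ≤ 1 → w ξ ≠ 0)
    (hφ : Tendsto (fun ξ => Real.sin (ξ + φ)) (atTop ⊓ 𝓟 {ξ | w ξ = 0}) (𝓝 0)) :
    ∃ (X : ℕ → ℝ) (N : ℤ), StrictMono X ∧ (∀ j, 1 < X j) ∧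
      (∀ ξ, 0 < ξ → (w ξ = 0 ↔ ∃ j, X j = ξ)) ∧
      (∀ j, |X j - ((N + j) * Real.pi - φ)| ≤ |Q| / X j) ∧ X 0 ≤ 1 + Real.pi + |Q| := by
  obtain ⟨θ, R, h⟩ := hw.exists_normalized_phase hne hφ
  have hθ := fun ξ hξ => (h ξ hξ).1
  have hpi := Real.pi_pos
  obtain ⟨hm, -⟩ := phase_bounds hθ
  have hmono : StrictMonoOn θ (Ici 1) := by
    refine strictMonoOn_of_deriv_pos (convex_Ici 1)
      (fun ξ hξ => (hθ ξ (one_pos.trans_le hξ)).continuousAt.continuousWithinAt) fun ξ hξ => ?_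
    rw [interior_Ici] at hξ
    have hξ1 : 1 < ξ := hξ
    rw [(hθ ξ (by linarith)).deriv]
    have h1 : |Q / ξ ^ 2 * Real.sin (θ ξ) ^ 2| ≤ |Q| := by
      rw [abs_mul, abs_div, abs_of_nonneg (sq_nonneg (Real.sin _)), abs_of_nonneg (sq_nonneg ξ)]
      have h2 : |Q| / ξ ^ 2 ≤ |Q| := div_le_self (abs_nonneg Q) (by nlinarith)
      exact (mul_le_of_le_one_right (by positivity) (Real.sin_sq_le_one _)).trans h2
    linarith [(abs_le.1 h1).1]
  set N : ℤ := ⌊θ 1 / Real.pi⌋ + 1 with hN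
  have hN1 : θ 1 < N * Real.pi := by
    rw [← div_lt_iff₀ hpi, hN]; push_cast; exact Int.lt_floor_add_one _
  have hN2 : (N : ℝ) * Real.pi ≤ θ 1 + Real.pi := by
    have := Int.floor_le (θ 1 / Real.pi)
    rw [le_div_iff₀ hpi] at this
    rw [hN]; push_cast; linarith
  have hval : ∀ j : ℕ, ∃ ξ, 1 ≤ ξ ∧ θ ξ = (N + j) * Real.pi := fun j =>
    phase_takes_value hθ one_pos (by nlinarith [(Nat.cast_nonneg j : (0 : ℝ) ≤ j)])
  choose X hX1 hX using hval
  have hXgt : ∀ j, 1 < X j := by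
    intro j
    rcases (hX1 j).lt_or_eq with h1 | h1
    · exact h1
    · have := hX j
      rw [← h1] at this
      nlinarith [(Nat.cast_nonneg j : (0 : ℝ) ≤ j)]
  have hXpos : ∀ j, 0 < X j := fun j => one_pos.trans (hXgt j)
  refine ⟨X, N, ?_, hXgt, ?_, ?_, ?_⟩
  · refine strictMono_nat_of_lt_succ fun j => ?_
    rw [← hmono.lt_iff_lt (mem_Ici.2 (hX1 j)) (mem_Ici.2 (hX1 (j + 1))), hX, hX]
    push_cast
    nlinarith
  · intro ξ hξ
    constructor
    · intro hz
      have h1 : 1 < ξ := not_le.1 fun hle => h01 ξ hξ hle hz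
      have hsin : Real.sin (θ ξ) = 0 := by
        have := (h ξ hξ).2.2.1
        rw [hz] at this
        exact (mul_eq_zero.1 this.symm).resolve_left (h ξ hξ).2.1
      obtain ⟨n, hn⟩ := Real.sin_eq_zero_iff.1 hsin
      have hlt : θ 1 < θ ξ := hmono (mem_Ici.2 le_rfl) (mem_Ici.2 h1.le) h1
      have hNn : N ≤ n := by
        rw [hN, Int.add_one_le_iff, Int.floor_lt, div_lt_iff₀ hpi, hn]
        exact hlt
      refine ⟨(n - N).toNat, hmono.injOn (mem_Ici.2 (hX1 _)) (mem_Ici.2 h1.le) ?_⟩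
      rw [hX, ← hn]
      congr 1
      have : ((n - N).toNat : ℤ) = n - N := Int.toNat_of_nonneg (by omega)
      have h2 : (((n - N).toNat : ℤ) : ℝ) = (n : ℝ) - N := by rw [this]; push_cast; rfl
      rw [Int.cast_natCast] at h2
      rw [h2]; ring
    · rintro ⟨j, rfl⟩
      rw [(h _ hξ).2.2.1, hX]
      have : ((N : ℝ) + j) = ((N + j : ℤ) : ℝ) := by push_cast; rfl
      rw [this, Real.sin_int_mul_pi, mul_zero]
  · intro j
    have h1 := (h (X j) (hXpos j)).2.2.2.2
    rw [hX] at h1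
    rwa [abs_sub_comm, show (N + j : ℝ) * Real.pi - φ - X j = (N + j) * Real.pi - X j - φ by ring]
  · have h1 := hm (mem_Ioi.2 one_pos) (mem_Ioi.2 (hXpos 0)) (hX1 0)
    simp only at h1
    rw [hX 0] at h1
    have h2 : 0 ≤ |Q| / X 0 := by have := hXpos 0; positivity
    push_cast at h1
    linarith

end CanonicalAiry

/-! ### The phase at infinity of the recessive solution -/

namespace CanonicalAiry
open Set Topology

/-- The imaginary part of `e^{i (ξ - a π / 2)} ξ^{a+1} L₀(ξ)` is a wave which is `o(ξ^{-a})` at `0`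
and asymptotic to `Γ(a + 1) sin (ξ - a π / 2)` at infinity. -/
theorem exists_hankelWave {a : ℝ} (ha : |a| < 1 / 2) :
    ∃ w w₁ : ℝ → ℝ, IsWave (-(a * (a + 1))) w w₁ ∧
      Tendsto (fun ξ => ξ ^ a * w ξ) (𝓝[>] 0) (𝓝 0) ∧
      ∃ K : ℝ, 0 < K ∧
        Tendsto (fun ξ => w ξ - K * Real.sin (ξ - a * Real.pi / 2)) atTop (𝓝 0) := by
  obtain ⟨ha1, ha2⟩ := abs_lt.1 ha
  set E : ℝ → ℂ := fun ξ => Complex.exp (((ξ - a * Real.pi / 2 : ℝ) : ℂ) * Complex.I) with hE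
  set P : ℝ → ℂ := fun ξ => ((ξ ^ (a + 1) : ℝ) : ℂ) with hP
  set L := hankelMoment a with hL
  have hE' : ∀ ξ, HasDerivAt E (Complex.I * E ξ) ξ := by
    intro ξ
    have h1 : HasDerivAt (fun ξ : ℝ => ξ - a * Real.pi / 2) 1 ξ := (hasDerivAt_id' ξ).sub_const _
    have := (h1.ofReal_comp.mul_const Complex.I).cexp
    convert! this using 1
    simp [hE, mul_comm]
  have hP' : ∀ ξ, 0 < ξ → HasDerivAt P ((a + 1) / ξ * P ξ) ξ := by
    intro ξ hξ
    have h1 := (Real.hasDerivAt_rpow_const (p := a + 1) (Or.inl hξ.ne')).ofReal_comp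
    convert! h1 using 1
    simp only [hP]
    rw [Real.rpow_sub_one hξ.ne']
    push_cast
    ring
  have hEP : ∀ k ξ, 0 < ξ → HasDerivAt (fun ξ => E ξ * P ξ * L k ξ)
      ((Complex.I + (a + 1) / ξ) * (E ξ * P ξ * L k ξ) - E ξ * P ξ * L (k + 1) ξ) ξ := by
    intro k ξ hξ
    refine (((hE' ξ).mul (hP' ξ hξ)).mul (hasDerivAt_hankelMoment ha k hξ)).congr_deriv ?_
    simp only [hL, Pi.mul_apply]
    ring
  set W : ℝ → ℂ := fun ξ => E ξ * P ξ * L 0 ξ with hW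
  set W₁ : ℝ → ℂ := fun ξ => (Complex.I + (a + 1) / ξ) * (E ξ * P ξ * L 0 ξ) - E ξ * P ξ * L 1 ξ
    with hW₁
  have hW₁' : ∀ ξ : ℝ, 0 < ξ → HasDerivAt W₁ (-(1 + -(a * (a + 1)) / ξ ^ 2 : ℝ) * W ξ) ξ := by
    intro ξ hξ
    have hξ' : (ξ : ℂ) ≠ 0 := Complex.ofReal_ne_zero.2 hξ.ne'
    have h1 : HasDerivAt (fun ξ : ℝ => Complex.I + ((a : ℂ) + 1) / (ξ : ℂ))
        (-((a : ℂ) + 1) / ξ ^ 2) ξ := by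
      have h2 := ((hasDerivAt_inv hξ.ne').ofReal_comp.const_mul ((a : ℂ) + 1)).const_add Complex.I
      convert! h2 using 1
      · funext x; push_cast; rw [div_eq_mul_inv]
      · push_cast; ring
    refine ((h1.mul (hEP 0 ξ hξ)).sub (hEP 1 ξ hξ)).congr_deriv ?_
    have hrec := hankelMoment_recurrence ha hξ
    rw [← hL] at hrec
    simp only [hW]
    push_cast
    have hI : Complex.I ^ 2 = -1 := Complex.I_sq
    have e : L 2 ξ = 2 * Complex.I * L 1 ξ -
        2 * (a + 1) * Complex.I * (L 0 ξ + Complex.I * L 1 ξ) / ξ := by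
      field_simp
      linear_combination (-2 * Complex.I) * hrec + (ξ * L 2 ξ) * hI
    rw [e]
    field_simp
    linear_combination ((E ξ * P ξ) * (-2 * (a + 1) * ξ * L 1 ξ + ξ ^ 2 * L 0 ξ)) * hI
  have him : ∀ {f : ℝ → ℂ} {f' : ℂ} {x : ℝ}, HasDerivAt f f' x →
      HasDerivAt (fun x => (f x).im) f'.im x :=
    fun h => Complex.imCLM.hasFDerivAt.comp_hasDerivAt _ h
  refine ⟨fun ξ => (W ξ).im, fun ξ => (W₁ ξ).im, ⟨fun ξ hξ => him (hEP 0 ξ hξ), fun ξ hξ => ?_⟩,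
    ?_, Real.Gamma (a + 1), Real.Gamma_pos_of_pos (by linarith), ?_⟩
  · refine (him (hW₁' ξ hξ)).congr_deriv ?_
    rw [← Complex.ofReal_neg, Complex.im_ofReal_mul]
  · obtain ⟨C, hC⟩ := hankelMoment_tendsto_zero ha
    have hEc : Tendsto E (𝓝[>] 0) (𝓝 (E 0)) :=
      (hE' 0).continuousAt.tendsto.mono_left nhdsWithin_le_nhds
    have h := (Complex.continuous_im.tendsto _).comp (hEc.mul hC)
    have e : (E 0 * (C * Complex.exp ((a * Real.pi / 2 : ℝ) * Complex.I))).im = 0 := by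
      have : E 0 * (C * Complex.exp ((a * Real.pi / 2 : ℝ) * Complex.I)) = C := by
        simp only [hE]
        rw [mul_left_comm, ← Complex.exp_add, ← add_mul, ← Complex.ofReal_add]
        simp
      rw [this, Complex.ofReal_im]
    rw [e] at h
    refine h.congr' ?_
    filter_upwards [self_mem_nhdsWithin] with ξ hξ
    have hξ' : (0 : ℝ) < ξ := hξ
    rw [← Complex.im_ofReal_mul, Function.comp]
    simp only [hW, hP]
    rw [show 2 * a + 1 = a + (a + 1) by ring, Real.rpow_add hξ']
    push_cast
    congr 1
    ring
  · have h := hankelMoment_tendsto_atTop ha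
    rw [tendsto_iff_norm_sub_tendsto_zero] at h
    refine squeeze_zero_norm (fun ξ => ?_) h
    have e : (W ξ).im - Real.Gamma (a + 1) * Real.sin (ξ - a * Real.pi / 2)
        = (E ξ * (P ξ * L 0 ξ - (Real.Gamma (a + 1) : ℝ))).im := by
      rw [mul_sub, Complex.sub_im, mul_comm (E ξ) ((Real.Gamma (a + 1) : ℝ) : ℂ),
        Complex.im_ofReal_mul, ← mul_assoc]
      simp only [hE, Complex.exp_ofReal_mul_I_im]
      rfl
    rw [e, Real.norm_eq_abs]
    refine (Complex.abs_im_le_norm _).trans ?_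
    rw [norm_mul, hE, Complex.norm_exp_ofReal_mul_I, one_mul]

theorem IsWave.wronskian {Q : ℝ} {w w₁ z z₁ : ℝ → ℝ} (hw : IsWave Q w w₁) (hz : IsWave Q z z₁)
    {x y : ℝ} (hx : 0 < x) (hy : 0 < y) : w x * z₁ x - w₁ x * z x = w y * z₁ y - w₁ y * z y :=
  eq_of_hasDerivAt_zero (f := fun x => w x * z₁ x - w₁ x * z x) (fun ξ hξ =>
    (((hw.hasDerivAt ξ hξ).mul (hz.hasDerivAt' ξ hξ)).sub
      ((hw.hasDerivAt' ξ hξ).mul (hz.hasDerivAt ξ hξ))).congr_deriv (by ring)) hx hy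

/-- A wave `w` that is small compared with the dominant solution `y` at `0` is a multiple of the
recessive one `z`, so it vanishes where `z` does. -/
theorem IsWave.zero_of_recessive {Q : ℝ} {w w₁ z z₁ y y₁ h : ℝ → ℝ} (hw : IsWave Q w w₁)
    (hz : IsWave Q z z₁) (hy : IsWave Q y y₁) {x₀ : ℝ} (hx₀ : 0 < x₀)
    (hne : z x₀ * y₁ x₀ - z₁ x₀ * y x₀ ≠ 0) (hw0 : Tendsto (fun ξ => h ξ * w ξ) (𝓝[>] 0) (𝓝 0))
    (hz0 : Tendsto (fun ξ => h ξ * z ξ) (𝓝[>] 0) (𝓝 0))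
    (hy0 : Tendsto (fun ξ => h ξ * y ξ) (𝓝[>] 0) (𝓝 1)) {ξ : ℝ} (hξ : 0 < ξ) (hzero : z ξ = 0) :
    w ξ = 0 := by
  set A := w x₀ * y₁ x₀ - w₁ x₀ * y x₀ with hA
  set B := w x₀ * z₁ x₀ - w₁ x₀ * z x₀ with hB
  set C := z x₀ * y₁ x₀ - z₁ x₀ * y x₀ with hC
  have key : ∀ x, 0 < x → C * w x = A * z x - B * y x := by
    intro x hx
    have h1 := hw.wronskian hy hx hx₀
    have h2 := hw.wronskian hz hx hx₀
    have h3 := hz.wronskian hy hx hx₀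
    rw [hA, hB, hC]
    rw [← h1, ← h2, ← h3]
    ring
  have hB0 : B = 0 := by
    have h1 := ((hz0.const_mul A).sub (hy0.const_mul B))
    have h2 := hw0.const_mul C
    have h3 : Tendsto (fun ξ => C * (h ξ * w ξ)) (𝓝[>] 0) (𝓝 (A * 0 - B * 1)) := by
      refine h1.congr' ?_
      filter_upwards [self_mem_nhdsWithin] with x hx
      linear_combination -h x * key x hx
    have := tendsto_nhds_unique h2 h3
    linarith
  have h1 := key ξ hξ
  rw [hzero, hB0] at h1
  simpa [hne] using h1

/-- The recessive solution at `0` has zeroes asymptotic to those of `sin (ξ - a π / 2)`. -/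
theorem IsWave.sin_tendsto_of_recessive {a : ℝ} (ha : |a| < 1 / 2) {z z₁ y y₁ : ℝ → ℝ}
    (hz : IsWave (-(a * (a + 1))) z z₁) (hy : IsWave (-(a * (a + 1))) y y₁)
    (hne : z 1 * y₁ 1 - z₁ 1 * y 1 ≠ 0)
    (hz0 : Tendsto (fun ξ => ξ ^ a * z ξ) (𝓝[>] 0) (𝓝 0))
    (hy0 : Tendsto (fun ξ => ξ ^ a * y ξ) (𝓝[>] 0) (𝓝 1)) :
    Tendsto (fun ξ => Real.sin (ξ + -(a * Real.pi / 2))) (atTop ⊓ 𝓟 {ξ | z ξ = 0}) (𝓝 0) := by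
  obtain ⟨w, w₁, hw, hw0, K, hK, hlim⟩ := exists_hankelWave ha
  have h1 := (hlim.const_mul (-K⁻¹)).mono_left
    (inf_le_left : atTop ⊓ 𝓟 {ξ | z ξ = 0} ≤ atTop)
  rw [mul_zero] at h1
  refine h1.congr' ?_
  have hpos : ∀ᶠ ξ : ℝ in atTop ⊓ 𝓟 {ξ | z ξ = 0}, 0 < ξ :=
    (eventually_gt_atTop (0 : ℝ)).filter_mono inf_le_left
  have hzero : ∀ᶠ ξ : ℝ in atTop ⊓ 𝓟 {ξ | z ξ = 0}, z ξ = 0 :=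
    (mem_inf_of_right (mem_principal_self _) : _)
  filter_upwards [hpos, hzero] with ξ hξ hz'
  rw [hw.zero_of_recessive hz hy one_pos hne hw0 hz0 hy0 hξ hz', ← sub_eq_add_neg]
  field_simp
  ring

end CanonicalAiry

/-! ### The Airy equation in the variable `ξ` -/

namespace CanonicalAiry
open Set Topology

theorem hasDerivAt_sol_neg (α β t : ℝ) :
    HasDerivAt (fun t => sol α β (-t)) (-deriv (sol α β) (-t)) t := by
  have h := (hasDerivAt_sol α β (-t)).scomp t (hasDerivAt_neg t)
  exact h.congr_deriv (by simp)

theorem hasDerivAt_deriv_sol_neg (α β t : ℝ) :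
    HasDerivAt (fun t => deriv (sol α β) (-t)) (t * sol α β (-t)) t := by
  have h := (hasDerivAt_deriv_sol α β (-t)).scomp t (hasDerivAt_neg t)
  exact h.congr_deriv (by simp)

theorem u_mul_deriv_v_sub (x : ℝ) : u x * deriv v x - deriv u x * v x = 1 := by
  have hd : ∀ x, HasDerivAt (fun x => u x * deriv v x - deriv u x * v x) 0 x := fun x =>
    (((hasDerivAt_sol 1 0 x).mul (hasDerivAt_deriv_sol 0 1 x)).sub
      ((hasDerivAt_deriv_sol 1 0 x).mul (hasDerivAt_sol 0 1 x))).congr_deriv (by ring)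
  have h := is_const_of_deriv_eq_zero (fun x => (hd x).differentiableAt) (fun x => (hd x).deriv) x 0
  simp only [u, v, sol_zero, deriv_sol_zero] at h ⊢
  simpa using h

/-- The derivative of `f f'` is `f'² + x f²`, which is positive for `x > 0`. -/
theorem sol_mul_deriv_pos {α β : ℝ} (h0 : α * β = 0)
    (hne : ∀ x, sol α β x = 0 → deriv (sol α β) x ≠ 0) {x : ℝ} (hx : 0 < x) :
    0 < sol α β x * deriv (sol α β) x := by
  have hd : ∀ x, HasDerivAt (fun x => sol α β x * deriv (sol α β) x)
      (deriv (sol α β) x ^ 2 + x * sol α β x ^ 2) x := fun x =>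
    ((hasDerivAt_sol α β x).mul (hasDerivAt_deriv_sol α β x)).congr_deriv (by ring)
  have hmono : StrictMonoOn (fun x => sol α β x * deriv (sol α β) x) (Ici 0) := by
    refine strictMonoOn_of_deriv_pos (convex_Ici 0)
      (fun x _ => (hd x).continuousAt.continuousWithinAt) fun y hy => ?_
    rw [interior_Ici] at hy
    have hy' : 0 < y := hy
    rw [(hd y).deriv]
    by_cases h : sol α β y = 0
    · have := hne y h
      positivity
    · positivity
  have := hmono (mem_Ici.2 le_rfl) (mem_Ici.2 hx.le) hx
  simp only [sol_zero, deriv_sol_zero, h0] at this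
  exact this

theorem deriv_u_ne_zero (x : ℝ) (h : u x = 0) : deriv u x ≠ 0 := by
  intro h'
  have := u_mul_deriv_v_sub x
  rw [h, h'] at this
  norm_num at this

theorem deriv_v_ne_zero (x : ℝ) (h : v x = 0) : deriv v x ≠ 0 := by
  intro h'
  have := u_mul_deriv_v_sub x
  rw [h, h'] at this
  norm_num at this

theorem u_mul_deriv_pos {x : ℝ} (hx : 0 < x) : 0 < u x * deriv u x :=
  sol_mul_deriv_pos (by norm_num) deriv_u_ne_zero hx

theorem v_mul_deriv_pos {x : ℝ} (hx : 0 < x) : 0 < v x * deriv v x :=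
  sol_mul_deriv_pos (by norm_num) deriv_v_ne_zero hx

theorem le_of_hasDerivAt_nonneg {f f' : ℝ → ℝ} {T s : ℝ} (hf : ∀ s, HasDerivAt f (f' s) s)
    (h : ∀ s ∈ Icc 0 T, 0 ≤ f' s) (hs : s ∈ Icc 0 T) : f 0 ≤ f s := by
  refine monotoneOn_of_deriv_nonneg (convex_Icc 0 T)
    (fun x _ => (hf x).continuousAt.continuousWithinAt)
    (fun x _ => (hf x).differentiableAt.differentiableWithinAt) ?_ ⟨le_rfl, hs.1.trans hs.2⟩ hs hs.1
  intro x hx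
  rw [(hf x).deriv]
  exact h x (interior_subset hx)

theorem lt_of_hasDerivAt_pos {f f' : ℝ → ℝ} {T : ℝ} (hT : 0 < T) (hf : ∀ s, HasDerivAt f (f' s) s)
    (h : ∀ s ∈ Ioo 0 T, 0 < f' s) : f 0 < f T := by
  refine strictMonoOn_of_deriv_pos (convex_Icc 0 T)
    (fun x _ => (hf x).continuousAt.continuousWithinAt) ?_ ⟨le_rfl, hT.le⟩ ⟨hT.le, le_rfl⟩ hT
  intro x hx
  rw [(hf x).deriv]
  exact h x (by rwa [interior_Icc] at hx)

theorem exists_first_zero {f : ℝ → ℝ} (hf : Continuous f) (h0 : 0 < f 0) {T : ℝ} (hT : 0 ≤ T)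
    (hfT : f T ≤ 0) : ∃ t ∈ Icc 0 T, f t = 0 ∧ ∀ s ∈ Icc 0 t, 0 ≤ f s := by
  have hc : IsCompact (Icc 0 T ∩ {t | f t = 0}) :=
    isCompact_Icc.inter_right (isClosed_eq hf continuous_const)
  obtain ⟨t₀, ht₀, he⟩ := intermediate_value_Icc' hT hf.continuousOn ⟨hfT, h0.le⟩
  obtain ⟨t, ht, hmin⟩ := hc.exists_isLeast ⟨t₀, ht₀, he⟩
  refine ⟨t, ht.1, ht.2, fun s hs => ?_⟩
  by_contra hneg
  push Not at hneg
  obtain ⟨r, hr, hre⟩ := intermediate_value_Icc' hs.1 hf.continuousOn ⟨hneg.le, h0.le⟩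
  have h1 : t ≤ r := hmin ⟨⟨hr.1, hr.2.trans (hs.2.trans ht.1.2)⟩, hre⟩
  have h2 : r = s := le_antisymm hr.2 (hs.2.trans h1)
  rw [← h2, hre] at hneg
  exact lt_irrefl _ hneg

theorem cube_le_of_le {s t : ℝ} (hs : 0 ≤ s) (hst : s ≤ t) (ht : t ^ 3 ≤ 9 / 4) : s ^ 3 ≤ 9 / 4 :=
  (pow_le_pow_left₀ hs hst 3).trans ht

/-- Up to the first zero of `u(-t)` one has `u(-t) ≤ 1`, hence `u'(-t) ≤ t² / 2` and
`u(-t) ≥ 1 - t³ / 6`, which is positive if `t³ ≤ 9/4`. -/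
theorem u_neg_pos {t : ℝ} (ht : 0 ≤ t) (ht3 : t ^ 3 ≤ 9 / 4) : 0 < u (-t) := by
  by_contra hneg
  push Not at hneg
  have hU := hasDerivAt_sol_neg 1 0
  have hU₁ := hasDerivAt_deriv_sol_neg 1 0
  obtain ⟨T, hT, hz, hpos⟩ := exists_first_zero (f := fun t => sol 1 0 (-t))
    (continuous_iff_continuousAt.2 fun t => (hU t).continuousAt) (by simp [sol_zero]) ht hneg
  have h1 : ∀ s ∈ Icc 0 T, 0 ≤ deriv (sol 1 0) (-s) := by
    intro s hs
    have := le_of_hasDerivAt_nonneg hU₁ (fun r hr => mul_nonneg hr.1 (hpos r hr)) hs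
    simpa [deriv_sol_zero] using this
  have h2 : ∀ s ∈ Icc 0 T, sol 1 0 (-s) ≤ 1 := by
    intro s hs
    have := le_of_hasDerivAt_nonneg (fun t => (hU t).neg) (fun r hr => by simpa using h1 r hr) hs
    simpa [sol_zero] using this
  have h3 : ∀ s ∈ Icc 0 T, deriv (sol 1 0) (-s) ≤ s ^ 2 / 2 := by
    intro s hs
    have := le_of_hasDerivAt_nonneg (fun t => ((hasDerivAt_pow 2 t).div_const 2).sub (hU₁ t))
      (fun r hr => by have := mul_le_mul_of_nonneg_left (h2 r hr) hr.1; norm_num; linarith) hs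
    simpa [deriv_sol_zero] using this
  have h4 := le_of_hasDerivAt_nonneg (fun t => ((hasDerivAt_pow 3 t).div_const 6).add (hU t))
      (fun r hr => by have := h3 r hr; norm_num; linarith) (⟨hT.1, le_rfl⟩ : T ∈ Icc 0 T)
  simp only [Pi.add_apply, neg_zero, sol_zero, hz] at h4
  have := cube_le_of_le hT.1 hT.2 ht3
  norm_num at h4
  linarith

theorem deriv_u_neg_pos {t : ℝ} (ht : 0 < t) (ht3 : t ^ 3 ≤ 9 / 4) : 0 < deriv u (-t) := by
  have h := lt_of_hasDerivAt_pos ht (hasDerivAt_deriv_sol_neg 1 0) fun s hs =>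
    mul_pos hs.1 (u_neg_pos hs.1.le (cube_le_of_le hs.1.le hs.2.le ht3))
  simpa [u, deriv_sol_zero] using h

/-- Up to the first zero of `v'(-t)` one has `v'(-t) ≤ 1`, hence `v(-t) ≥ -t` and
`v'(-t) ≥ 1 - t³ / 3`, which is positive if `t³ ≤ 9/4`. -/
theorem deriv_v_neg_pos {t : ℝ} (ht : 0 ≤ t) (ht3 : t ^ 3 ≤ 9 / 4) : 0 < deriv v (-t) := by
  by_contra hneg
  push Not at hneg
  have hV := hasDerivAt_sol_neg 0 1
  have hV₁ := hasDerivAt_deriv_sol_neg 0 1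
  obtain ⟨T, hT, hz, hpos⟩ := exists_first_zero (f := fun t => deriv (sol 0 1) (-t))
    (continuous_iff_continuousAt.2 fun t => (hV₁ t).continuousAt) (by simp [deriv_sol_zero]) ht hneg
  have h1 : ∀ s ∈ Icc 0 T, sol 0 1 (-s) ≤ 0 := by
    intro s hs
    have := le_of_hasDerivAt_nonneg (fun t => (hV t).neg) (fun r hr => by simpa using hpos r hr) hs
    simpa [sol_zero] using this
  have h2 : ∀ s ∈ Icc 0 T, deriv (sol 0 1) (-s) ≤ 1 := by
    intro s hs
    have := le_of_hasDerivAt_nonneg (fun t => (hV₁ t).neg)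
      (fun r hr => by
        simpa using mul_nonpos_of_nonneg_of_nonpos hr.1 (h1 r hr)) hs
    simpa [deriv_sol_zero] using this
  have h3 : ∀ s ∈ Icc 0 T, -s ≤ sol 0 1 (-s) := by
    intro s hs
    have := le_of_hasDerivAt_nonneg (fun t => (hasDerivAt_id t).add (hV t))
      (fun r hr => by have := h2 r hr; linarith) hs
    simp only [Pi.add_apply, id, neg_zero, sol_zero] at this
    linarith
  have h4 := le_of_hasDerivAt_nonneg (fun t => ((hasDerivAt_pow 3 t).div_const 3).add (hV₁ t))
      (fun r hr => by have := mul_le_mul_of_nonneg_left (h3 r hr) hr.1; norm_num; nlinarith)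
      (⟨hT.1, le_rfl⟩ : T ∈ Icc 0 T)
  simp only [Pi.add_apply, neg_zero, deriv_sol_zero, hz] at h4
  have := cube_le_of_le hT.1 hT.2 ht3
  norm_num at h4
  linarith

theorem v_neg_neg {t : ℝ} (ht : 0 < t) (ht3 : t ^ 3 ≤ 9 / 4) : v (-t) < 0 := by
  have h := lt_of_hasDerivAt_pos ht (fun t => (hasDerivAt_sol_neg 0 1 t).neg) fun s hs => by
    simpa [v] using deriv_v_neg_pos hs.1.le (cube_le_of_le hs.1.le hs.2.le ht3)
  simpa [v, sol_zero] using h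

/-- The constant `(2/3)^{1/3}`. -/
noncomputable def kappa : ℝ := (2 / 3 : ℝ) ^ (1 / 3 : ℝ)

theorem kappa_pos : 0 < kappa := by unfold kappa; positivity

theorem kappa_cube : kappa ^ 3 = 2 / 3 := by
  rw [kappa, ← Real.rpow_natCast, ← Real.rpow_mul (by norm_num)]; norm_num

/-- The inverse `x = (3 ξ / 2)^{2/3}` of `ξ = (2/3) x ^ (3/2)`. -/
noncomputable def airyArg (ξ : ℝ) : ℝ := ξ ^ (2 / 3 : ℝ) / kappa ^ 2

theorem airyArg_pos {ξ : ℝ} (hξ : 0 < ξ) : 0 < airyArg ξ :=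
  div_pos (Real.rpow_pos_of_pos hξ _) (pow_pos kappa_pos 2)

theorem airyArg_cube {ξ : ℝ} (hξ : 0 ≤ ξ) : airyArg ξ ^ 3 = 9 / 4 * ξ ^ 2 := by
  rw [airyArg, div_pow, ← pow_mul, pow_mul' kappa 2 3, kappa_cube,
    ← Real.rpow_natCast (ξ ^ (2 / 3 : ℝ)), ← Real.rpow_mul hξ]
  norm_num
  ring

theorem airyArg_strictMonoOn : StrictMonoOn airyArg (Ici 0) := by
  intro x hx y _ hxy
  exact div_lt_div_of_pos_right (Real.rpow_lt_rpow hx hxy (by norm_num)) (pow_pos kappa_pos 2)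

theorem xi_airyArg {ξ : ℝ} (hξ : 0 ≤ ξ) : 2 / 3 * airyArg ξ ^ (3 / 2 : ℝ) = ξ := by
  have hk := kappa_pos
  rw [airyArg, Real.div_rpow (by positivity) (by positivity), ← Real.rpow_mul hξ,
    ← Real.rpow_natCast kappa 2, ← Real.rpow_mul hk.le]
  norm_num
  rw [kappa_cube]
  ring

theorem airyArg_xi {x : ℝ} (hx : 0 ≤ x) : airyArg (2 / 3 * x ^ (3 / 2 : ℝ)) = x := by
  rw [airyArg, Real.mul_rpow (by norm_num) (by positivity), ← Real.rpow_mul hx, kappa,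
    ← Real.rpow_natCast, ← Real.rpow_mul (by norm_num)]
  norm_num

theorem airyArg_eq {ξ : ℝ} (hξ : 0 ≤ ξ) : airyArg ξ = (3 * ξ / 2) ^ (2 / 3 : ℝ) := by
  rw [show 3 * ξ / 2 = ξ / (2 / 3) by ring, Real.div_rpow hξ (by norm_num), airyArg, kappa,
    ← Real.rpow_natCast, ← Real.rpow_mul (by norm_num)]
  norm_num

theorem hasDerivAt_airyArg {ξ : ℝ} (hξ : 0 < ξ) :
    HasDerivAt airyArg (kappa * ξ ^ (-(1 / 3) : ℝ)) ξ := by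
  have h := (Real.hasDerivAt_rpow_const (p := 2 / 3) (Or.inl hξ.ne')).div_const (kappa ^ 2)
  refine h.congr_deriv ?_
  have hk := kappa_pos.ne'
  rw [div_eq_iff (pow_ne_zero 2 hk), show kappa * ξ ^ (-(1 / 3) : ℝ) * kappa ^ 2
    = kappa ^ 3 * ξ ^ (-(1 / 3) : ℝ) by ring, kappa_cube]
  norm_num

theorem tendsto_airyArg_zero : Tendsto airyArg (𝓝[>] 0) (𝓝 0) := by
  have h : ContinuousAt airyArg 0 :=
    (Real.continuousAt_rpow_const 0 (2 / 3) (Or.inr (by norm_num))).div_const _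
  have h0 : airyArg 0 = 0 := by simp [airyArg]
  have := h.tendsto
  rw [h0] at this
  exact this.mono_left nhdsWithin_le_nhds

/-- The wave `ξ^{1/6} f(-x)`, with `x = (3 ξ / 2)^{2/3}`, of the solution `f = sol α β`. -/
noncomputable def solWave (α β ξ : ℝ) : ℝ := ξ ^ (1 / 6 : ℝ) * sol α β (-airyArg ξ)

/-- The wave `ξ^{-1/6} f'(-x)`, with `x = (3 ξ / 2)^{2/3}`, of the derivative of `f = sol α β`. -/
noncomputable def derivWave (α β ξ : ℝ) : ℝ := ξ ^ (-(1 / 6) : ℝ) * deriv (sol α β) (-airyArg ξ)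

theorem hasDerivAt_solWave (α β : ℝ) {ξ : ℝ} (hξ : 0 < ξ) : HasDerivAt (solWave α β)
    (solWave α β ξ / (6 * ξ) - kappa * derivWave α β ξ) ξ := by
  have h1 := Real.hasDerivAt_rpow_const (p := 1 / 6) (Or.inl hξ.ne')
  have h2 := (hasDerivAt_sol_neg α β (airyArg ξ)).comp ξ (hasDerivAt_airyArg hξ)
  refine (h1.mul h2).congr_deriv ?_
  rw [solWave, derivWave, Function.comp, Real.rpow_sub_one hξ.ne',
    show (-(1 / 6) : ℝ) = 1 / 6 + -(1 / 3) by norm_num, Real.rpow_add hξ]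
  field_simp
  ring

theorem hasDerivAt_derivWave (α β : ℝ) {ξ : ℝ} (hξ : 0 < ξ) : HasDerivAt (derivWave α β)
    (-derivWave α β ξ / (6 * ξ) + solWave α β ξ / kappa) ξ := by
  have hk := kappa_pos.ne'
  have h1 := Real.hasDerivAt_rpow_const (p := -(1 / 6)) (Or.inl hξ.ne')
  have h2 := (hasDerivAt_deriv_sol_neg α β (airyArg ξ)).comp ξ (hasDerivAt_airyArg hξ)
  refine (h1.mul h2).congr_deriv ?_
  have e : ξ ^ (-(1 / 6) : ℝ) * (airyArg ξ * (kappa * ξ ^ (-(1 / 3) : ℝ)))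
      = ξ ^ (1 / 6 : ℝ) / kappa := by
    have e1 : ξ ^ (1 / 6 : ℝ) = ξ ^ (-(1 / 6) : ℝ) * ξ ^ (2 / 3 : ℝ) * ξ ^ (-(1 / 3) : ℝ) := by
      rw [← Real.rpow_add hξ, ← Real.rpow_add hξ]; norm_num
    rw [airyArg, e1]
    field_simp
  rw [solWave, derivWave, Function.comp, Real.rpow_sub_one hξ.ne']
  linear_combination sol α β (-airyArg ξ) * e

theorem solWave_isWave (α β : ℝ) : IsWave (-(-(1 / 6) * (-(1 / 6) + 1))) (solWave α β)
    (fun ξ => solWave α β ξ / (6 * ξ) - kappa * derivWave α β ξ) := by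
  refine ⟨fun ξ hξ => hasDerivAt_solWave α β hξ, fun ξ hξ => ?_⟩
  have hk := kappa_pos.ne'
  refine (((hasDerivAt_solWave α β hξ).div ((hasDerivAt_id' ξ).const_mul 6) (by positivity)).sub
    ((hasDerivAt_derivWave α β hξ).const_mul kappa)).congr_deriv ?_
  field_simp
  ring

theorem derivWave_isWave (α β : ℝ) : IsWave (-(1 / 6 * (1 / 6 + 1))) (derivWave α β)
    (fun ξ => -derivWave α β ξ / (6 * ξ) + solWave α β ξ / kappa) := by
  refine ⟨fun ξ hξ => hasDerivAt_derivWave α β hξ, fun ξ hξ => ?_⟩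
  have hk := kappa_pos.ne'
  refine (((hasDerivAt_derivWave α β hξ).neg.div ((hasDerivAt_id' ξ).const_mul 6)
    (by positivity)).add ((hasDerivAt_solWave α β hξ).div_const kappa)).congr_deriv ?_
  simp only [Pi.neg_apply]
  field_simp
  ring

theorem solWave_eq_zero {α β ξ : ℝ} (hξ : 0 < ξ) :
    solWave α β ξ = 0 ↔ sol α β (-airyArg ξ) = 0 := by
  have := (Real.rpow_pos_of_pos hξ (1 / 6)).ne'
  simp only [solWave, mul_eq_zero, this, false_or]

theorem derivWave_eq_zero {α β ξ : ℝ} (hξ : 0 < ξ) :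
    derivWave α β ξ = 0 ↔ deriv (sol α β) (-airyArg ξ) = 0 := by
  have := (Real.rpow_pos_of_pos hξ (-(1 / 6))).ne'
  simp only [derivWave, mul_eq_zero, this, false_or]

theorem solWave_tendsto (α β : ℝ) :
    Tendsto (fun ξ => ξ ^ (-(1 / 6) : ℝ) * solWave α β ξ) (𝓝[>] 0) (𝓝 α) := by
  have h1 : Tendsto (fun t => sol α β (-t)) (𝓝 0) (𝓝 α) := by
    simpa [sol_zero] using (hasDerivAt_sol_neg α β 0).continuousAt.tendsto
  refine (h1.comp tendsto_airyArg_zero).congr' ?_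
  filter_upwards [self_mem_nhdsWithin] with ξ hξ
  rw [solWave, ← mul_assoc, ← Real.rpow_add hξ]
  norm_num

theorem derivWave_tendsto (α β : ℝ) :
    Tendsto (fun ξ => ξ ^ (1 / 6 : ℝ) * derivWave α β ξ) (𝓝[>] 0) (𝓝 β) := by
  have h1 : Tendsto (fun t => deriv (sol α β) (-t)) (𝓝 0) (𝓝 β) := by
    simpa [deriv_sol_zero] using (hasDerivAt_deriv_sol_neg α β 0).continuousAt.tendsto
  refine (h1.comp tendsto_airyArg_zero).congr' ?_
  filter_upwards [self_mem_nhdsWithin] with ξ hξ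
  rw [derivWave, ← mul_assoc, ← Real.rpow_add hξ]
  norm_num

theorem wave_wronskian {ξ : ℝ} (hξ : 0 < ξ) :
    solWave 1 0 ξ * derivWave 0 1 ξ - derivWave 1 0 ξ * solWave 0 1 ξ = 1 := by
  have h := u_mul_deriv_v_sub (-airyArg ξ)
  have e : ξ ^ (1 / 6 : ℝ) * ξ ^ (-(1 / 6) : ℝ) = 1 := by
    rw [← Real.rpow_add hξ]; norm_num
  simp only [u, v] at h
  simp only [solWave, derivWave]
  linear_combination (sol 1 0 (-airyArg ξ) * deriv (sol 0 1) (-airyArg ξ)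
    - deriv (sol 1 0) (-airyArg ξ) * sol 0 1 (-airyArg ξ)) * e + h

/-- If `w' = b w / ξ` at the zeroes of `s`, these zeroes are asymptotic to those of
`cos (ξ + φ)`. -/
theorem IsWave.sin_tendsto_of_critical {Q φ b : ℝ} {w w₁ s : ℝ → ℝ} (hw : IsWave Q w w₁)
    (hne : ∀ ξ, 0 < ξ → w ξ = 0 → w₁ ξ ≠ 0)
    (hφ : Tendsto (fun ξ => Real.sin (ξ + φ)) (atTop ⊓ 𝓟 {ξ | w ξ = 0}) (𝓝 0))
    (hs : ∀ ξ, 0 < ξ → s ξ = 0 → w₁ ξ = b * w ξ / ξ) :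
    Tendsto (fun ξ => Real.sin (ξ + (φ + Real.pi / 2))) (atTop ⊓ 𝓟 {ξ | s ξ = 0}) (𝓝 0) := by
  obtain ⟨θ, R, h⟩ := hw.exists_normalized_phase hne hφ
  have hlim : Tendsto (fun ξ : ℝ => (|b| + |Q|) / ξ) (atTop ⊓ 𝓟 {ξ | s ξ = 0}) (𝓝 0) :=
    (tendsto_const_nhds.div_atTop tendsto_id).mono_left inf_le_left
  refine squeeze_zero_norm' ?_ hlim
  have hpos : ∀ᶠ ξ : ℝ in atTop ⊓ 𝓟 {ξ | s ξ = 0}, 0 < ξ :=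
    (eventually_gt_atTop (0 : ℝ)).filter_mono inf_le_left
  have hzero : ∀ᶠ ξ : ℝ in atTop ⊓ 𝓟 {ξ | s ξ = 0}, s ξ = 0 :=
    (mem_inf_of_right (mem_principal_self _) : _)
  filter_upwards [hpos, hzero] with ξ hξ hz
  obtain ⟨-, hR, e1, e2, hθ⟩ := h ξ hξ
  have hcos : Real.cos (θ ξ) = b * Real.sin (θ ξ) / ξ := by
    have := hs ξ hξ hz
    rw [e1, e2] at this
    have h3 : R ξ * Real.cos (θ ξ) = R ξ * (b * Real.sin (θ ξ) / ξ) := by rw [this]; ring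
    exact mul_left_cancel₀ hR h3
  have h1 : |Real.cos (θ ξ)| ≤ |b| / ξ := by
    rw [hcos, abs_div, abs_mul, abs_of_pos hξ]
    gcongr
    exact mul_le_of_le_one_right (abs_nonneg b) (Real.abs_sin_le_one _)
  have h2 : |Real.cos (ξ + φ) - Real.cos (θ ξ)| ≤ |Q| / ξ := by
    have h4 : |Real.cos (ξ + φ) - Real.cos (θ ξ)| ≤ |ξ + φ - θ ξ| :=
      Real.abs_cos_sub_cos_le _ _
    rw [abs_sub_comm (ξ + φ), ← sub_sub] at h4
    exact h4.trans hθ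
  rw [← add_assoc, Real.sin_add_pi_div_two, Real.norm_eq_abs, add_div]
  calc |Real.cos (ξ + φ)| = |(Real.cos (ξ + φ) - Real.cos (θ ξ)) + Real.cos (θ ξ)| := by
        rw [sub_add_cancel]
    _ ≤ |Real.cos (ξ + φ) - Real.cos (θ ξ)| + |Real.cos (θ ξ)| := abs_add_le _ _
    _ ≤ _ := by linarith

/-- For the phase shifts and potentials in question the index of the first zero is determined. -/
theorem IsWave.exists_indexed_zeros {Q φ : ℝ} {w w₁ : ℝ → ℝ} (hw : IsWave Q w w₁)
    (hQ : |Q| ≤ 7 / 36) (hφ1 : -(Real.pi / 12) ≤ φ) (hφ2 : φ ≤ 7 * Real.pi / 12)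
    (hne : ∀ ξ, 0 < ξ → w ξ = 0 → w₁ ξ ≠ 0) (h01 : ∀ ξ, 0 < ξ → ξ ≤ 1 → w ξ ≠ 0)
    (hφ : Tendsto (fun ξ => Real.sin (ξ + φ)) (atTop ⊓ 𝓟 {ξ | w ξ = 0}) (𝓝 0)) :
    ∃ X : ℕ → ℝ, StrictMono X ∧ (∀ j, 1 < X j) ∧ (∀ ξ, 0 < ξ → (w ξ = 0 ↔ ∃ j, X j = ξ)) ∧
      ∀ j : ℕ, |X j - (j * Real.pi + (Real.pi - φ))| ≤ |Q| / X j := by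
  obtain ⟨X, N, hX, hX1, hX0, hXN, hXB⟩ := hw.exists_zeros (by linarith) hne h01 hφ
  have hp1 := Real.pi_gt_d2
  have hp2 := Real.pi_lt_d2
  have h1 := hX1 0
  have hpos : 0 < X 0 := by linarith
  have h0 := abs_le.1 (hXN 0)
  have hq1 : |Q| / X 0 ≤ 7 / 36 := (div_le_self (abs_nonneg Q) h1.le).trans hQ
  push_cast at h0
  -- If `N ≤ 0`, then `X 0 ≤ π / 12 + 7 / 36 < 1`; if `N ≥ 2`, then
  -- `X 0 ≥ 17 π / 12 - 7 / 144 > 1 + π + 7 / 36`.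
  have hN1 : N = 1 := by
    rcases lt_trichotomy N 1 with h | h | h
    · exfalso
      have : (N : ℝ) ≤ 0 := by exact_mod_cast Int.lt_add_one_iff.1 h
      nlinarith
    · exact h
    · exfalso
      have h2 : (2 : ℝ) ≤ N := by exact_mod_cast h
      have h3 : 2 * Real.pi ≤ N * Real.pi := by nlinarith
      have h4 : 4 ≤ X 0 := by linarith
      have h5 : |Q| / X 0 ≤ 7 / 36 / 4 := by gcongr
      linarith
  refine ⟨X, hX, hX1, hX0, fun j => ?_⟩
  have := hXN j
  rw [hN1] at this
  convert! this using 3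
  push_cast
  ring

theorem negZero_eq {f : ℝ → ℝ} {Y : ℕ → ℝ} (hY : StrictMono Y) (h0 : 0 < Y 0)
    (hf : ∀ x, 0 < x → (f (-x) = 0 ↔ ∃ j, Y j = x)) (j : ℕ) : negZero f j = Y j := by
  have hpos : ∀ j, 0 < Y j := fun j => h0.trans_le (hY.monotone (Nat.zero_le j))
  induction j with
  | zero =>
    refine IsLeast.csInf_eq ⟨⟨h0, (hf _ h0).2 ⟨0, rfl⟩⟩, ?_⟩
    rintro x ⟨hx, hfx⟩
    obtain ⟨i, rfl⟩ := (hf x hx).1 hfx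
    exact hY.monotone (Nat.zero_le i)
  | succ j ih =>
    rw [negZero, ih]
    refine IsLeast.csInf_eq ⟨⟨hY (Nat.lt_succ_self j), (hf _ (hpos _)).2 ⟨j + 1, rfl⟩⟩, ?_⟩
    rintro x ⟨hx, hfx⟩
    obtain ⟨i, rfl⟩ := (hf x ((hpos j).trans hx)).1 hfx
    exact hY.monotone (hY.lt_iff_lt.1 hx)

/-- Passing from the zeroes of a wave in `ξ` to the negative zeroes of `f`. -/
theorem negZero_eq_airyArg {f w : ℝ → ℝ} (hw : ∀ ξ, 0 < ξ → (w ξ = 0 ↔ f (-airyArg ξ) = 0))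
    {X : ℕ → ℝ} (hX : StrictMono X) (hX1 : ∀ j, 1 < X j)
    (hz : ∀ ξ, 0 < ξ → (w ξ = 0 ↔ ∃ j, X j = ξ)) :
    (∀ j, negZero f j = airyArg (X j)) ∧ ∀ x, 0 < x → (f (-x) = 0 ↔ ∃ j, negZero f j = x) := by
  have hX0 : ∀ j, 0 ≤ X j := fun j => by linarith [hX1 j]
  have hmono : StrictMono fun j => airyArg (X j) := fun i j hij =>
    airyArg_strictMonoOn (hX0 i) (hX0 j) (hX hij)
  have hiff : ∀ x, 0 < x → (f (-x) = 0 ↔ ∃ j, airyArg (X j) = x) := by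
    intro x hx
    have hxi : 0 < 2 / 3 * x ^ (3 / 2 : ℝ) := by positivity
    have h1 := (hw _ hxi).symm.trans (hz _ hxi)
    rw [airyArg_xi hx.le] at h1
    rw [h1]
    refine exists_congr fun j => ⟨fun h => ?_, fun h => ?_⟩
    · rw [h, airyArg_xi hx.le]
    · rw [← h, xi_airyArg (hX0 j)]
  have hneg := negZero_eq hmono (airyArg_pos (by linarith [hX1 0])) hiff
  exact ⟨hneg, fun x hx => by simp only [hneg, hiff x hx]⟩

end CanonicalAiry

/-! ### Location of the zeroes of `u`, `v`, `u'` and `v'` -/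

namespace CanonicalAiry
open Set Topology

/-- The opposites `x_j` of the negative zeroes of `f` are listed by `negZero f`, and the numbers
`ξ_j = (2/3) x_j ^ (3/2)` satisfy `|ξ_j - (j π + μ)| ≤ q / ξ_j`. -/
structure HasZeros (f : ℝ → ℝ) (q μ : ℝ) : Prop where
  strictMono : StrictMono (negZero f)
  pos : ∀ j, 0 < negZero f j
  zero_iff : ∀ x, 0 < x → (f (-x) = 0 ↔ ∃ j, negZero f j = x)
  le_xi : ∀ j : ℕ, (j : ℝ) + 1 ≤ 2 / 3 * negZero f j ^ (3 / 2 : ℝ)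
  xi_bound : ∀ j : ℕ, |2 / 3 * negZero f j ^ (3 / 2 : ℝ) - (j * Real.pi + μ)| ≤
    q / (2 / 3 * negZero f j ^ (3 / 2 : ℝ))

/-- The hypothesis on `t³ ≤ 9/4` excludes zeroes with `ξ ≤ 1`. -/
theorem hasZeros_of_wave {Q φ : ℝ} {f w w₁ : ℝ → ℝ} (hw : IsWave Q w w₁)
    (hwf : ∀ ξ, 0 < ξ → (w ξ = 0 ↔ f (-airyArg ξ) = 0))
    (hQ : |Q| ≤ 7 / 36) (hφ1 : -(Real.pi / 12) ≤ φ) (hφ2 : φ ≤ 7 * Real.pi / 12)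
    (hne : ∀ ξ, 0 < ξ → w ξ = 0 → w₁ ξ ≠ 0) (hf : ∀ t, 0 < t → t ^ 3 ≤ 9 / 4 → f (-t) ≠ 0)
    (hφ : Tendsto (fun ξ => Real.sin (ξ + φ)) (atTop ⊓ 𝓟 {ξ | w ξ = 0}) (𝓝 0)) :
    HasZeros f |Q| (Real.pi - φ) := by
  have h01 : ∀ ξ, 0 < ξ → ξ ≤ 1 → w ξ ≠ 0 := by
    intro ξ hξ hξ1 h
    refine hf _ (airyArg_pos hξ) ?_ ((hwf ξ hξ).1 h)
    rw [airyArg_cube hξ.le]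
    nlinarith
  obtain ⟨X, hX, hX1, hXz, hXb⟩ := hw.exists_indexed_zeros hQ hφ1 hφ2 hne h01 hφ
  obtain ⟨h1, h2⟩ := negZero_eq_airyArg hwf hX hX1 hXz
  have hX0 : ∀ j, 0 < X j := fun j => by linarith [hX1 j]
  have hxi : ∀ j, 2 / 3 * negZero f j ^ (3 / 2 : ℝ) = X j := fun j => by
    rw [h1, xi_airyArg (hX0 j).le]
  refine ⟨fun i j hij => ?_, fun j => ?_, h2, fun j => ?_, fun j => ?_⟩
  · rw [h1, h1]
    exact airyArg_strictMonoOn (hX0 i).le (hX0 j).le (hX hij)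
  · rw [h1]
    exact airyArg_pos (hX0 j)
  · rw [hxi]
    have h3 := (abs_le.1 (hXb j)).1
    have h4 : |Q| / X j ≤ 7 / 36 := (div_le_self (abs_nonneg Q) (hX1 j).le).trans hQ
    have h5 : (0 : ℝ) ≤ j := Nat.cast_nonneg j
    nlinarith [Real.pi_gt_d2]
  · rw [hxi]
    exact hXb j

/-- The waves of `u`, `v`, `u'`, `v'` have simple zeroes. -/
theorem wave_simple_zeros (ξ : ℝ) (hξ : 0 < ξ) :
    (solWave 1 0 ξ = 0 → solWave 1 0 ξ / (6 * ξ) - kappa * derivWave 1 0 ξ ≠ 0) ∧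
    (solWave 0 1 ξ = 0 → solWave 0 1 ξ / (6 * ξ) - kappa * derivWave 0 1 ξ ≠ 0) ∧
    (derivWave 1 0 ξ = 0 → -derivWave 1 0 ξ / (6 * ξ) + solWave 1 0 ξ / kappa ≠ 0) ∧
    (derivWave 0 1 ξ = 0 → -derivWave 0 1 ξ / (6 * ξ) + solWave 0 1 ξ / kappa ≠ 0) := by
  have h := wave_wronskian hξ
  have hk := kappa_pos.ne'
  refine ⟨fun h0 h1 => ?_, fun h0 h1 => ?_, fun h0 h1 => ?_, fun h0 h1 => ?_⟩ <;>
  · rw [h0] at h1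
    simp [hk] at h1
    rw [h0, h1] at h
    simp at h

theorem sin_tendsto_derivWave_one_zero : Tendsto (fun ξ => Real.sin (ξ + -(Real.pi / 12)))
    (atTop ⊓ 𝓟 {ξ | derivWave 1 0 ξ = 0}) (𝓝 0) := by
  have h := (derivWave_isWave 1 0).sin_tendsto_of_recessive (by norm_num [abs_lt])
    (derivWave_isWave 0 1) ?_ (derivWave_tendsto 1 0) (derivWave_tendsto 0 1)
  · rwa [show 1 / 6 * Real.pi / 2 = Real.pi / 12 by ring] at h
  · have hk := kappa_pos
    have e : derivWave 1 0 1 * (-derivWave 0 1 1 / (6 * 1) + solWave 0 1 1 / kappa)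
        - (-derivWave 1 0 1 / (6 * 1) + solWave 1 0 1 / kappa) * derivWave 0 1 1 =
        -(1 / kappa) := by
      linear_combination (-1 / kappa) * wave_wronskian one_pos
    rw [e]
    exact neg_ne_zero.2 (one_div_pos.2 hk).ne'

theorem sin_tendsto_solWave_zero_one : Tendsto (fun ξ => Real.sin (ξ + Real.pi / 12))
    (atTop ⊓ 𝓟 {ξ | solWave 0 1 ξ = 0}) (𝓝 0) := by
  have h := (solWave_isWave 0 1).sin_tendsto_of_recessive (by norm_num [abs_lt])
    (solWave_isWave 1 0) ?_ (solWave_tendsto 0 1) (solWave_tendsto 1 0)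
  · rwa [show -(-(1 / 6) * Real.pi / 2) = Real.pi / 12 by ring] at h
  · have e : solWave 0 1 1 * (solWave 1 0 1 / (6 * 1) - kappa * derivWave 1 0 1)
        - (solWave 0 1 1 / (6 * 1) - kappa * derivWave 0 1 1) * solWave 1 0 1 = kappa := by
      linear_combination kappa * wave_wronskian one_pos
    rw [e]
    exact kappa_pos.ne'

theorem sin_tendsto_solWave_one_zero : Tendsto (fun ξ => Real.sin (ξ + 5 * Real.pi / 12))
    (atTop ⊓ 𝓟 {ξ | solWave 1 0 ξ = 0}) (𝓝 0) := by
  have h := (derivWave_isWave 1 0).sin_tendsto_of_critical (s := solWave 1 0) (b := -(1 / 6))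
    (fun ξ hξ => (wave_simple_zeros ξ hξ).2.2.1) sin_tendsto_derivWave_one_zero
    (fun ξ hξ h0 => by simp only [h0]; ring)
  rwa [show -(Real.pi / 12) + Real.pi / 2 = 5 * Real.pi / 12 by ring] at h

theorem sin_tendsto_derivWave_zero_one : Tendsto (fun ξ => Real.sin (ξ + 7 * Real.pi / 12))
    (atTop ⊓ 𝓟 {ξ | derivWave 0 1 ξ = 0}) (𝓝 0) := by
  have h := (solWave_isWave 0 1).sin_tendsto_of_critical (s := derivWave 0 1) (b := 1 / 6)
    (fun ξ hξ => (wave_simple_zeros ξ hξ).2.1) sin_tendsto_solWave_zero_one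
    (fun ξ hξ h0 => by simp only [h0]; ring)
  rwa [show Real.pi / 12 + Real.pi / 2 = 7 * Real.pi / 12 by ring] at h

theorem hasZeros_deriv_v : HasZeros (deriv v) (7 / 36) (5 * Real.pi / 12) := by
  have hQ : |(-(1 / 6 * (1 / 6 + 1)) : ℝ)| = 7 / 36 := by norm_num [abs]
  have hpi := Real.pi_pos
  have h := hasZeros_of_wave (f := deriv v) (derivWave_isWave 0 1)
    (fun ξ hξ => derivWave_eq_zero hξ) hQ.le (by linarith) le_rfl
    (fun ξ hξ => (wave_simple_zeros ξ hξ).2.2.2) (fun t ht ht3 => (deriv_v_neg_pos ht.le ht3).ne')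
    sin_tendsto_derivWave_zero_one
  rwa [hQ, show Real.pi - 7 * Real.pi / 12 = 5 * Real.pi / 12 by ring] at h

theorem hasZeros_v : HasZeros v (5 / 36) (11 * Real.pi / 12) := by
  have hQ : |(-(-(1 / 6) * (-(1 / 6) + 1)) : ℝ)| = 5 / 36 := by norm_num [abs]
  have hpi := Real.pi_pos
  have h := hasZeros_of_wave (f := v) (solWave_isWave 0 1)
    (fun ξ hξ => solWave_eq_zero hξ) (by rw [hQ]; norm_num) (by linarith) (by linarith)
    (fun ξ hξ => (wave_simple_zeros ξ hξ).2.1) (fun t ht ht3 => (v_neg_neg ht ht3).ne)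
    sin_tendsto_solWave_zero_one
  rwa [hQ, show Real.pi - Real.pi / 12 = 11 * Real.pi / 12 by ring] at h

theorem hasZeros_u : HasZeros u (5 / 36) (7 * Real.pi / 12) := by
  have hQ : |(-(-(1 / 6) * (-(1 / 6) + 1)) : ℝ)| = 5 / 36 := by norm_num [abs]
  have hpi := Real.pi_pos
  have h := hasZeros_of_wave (f := u) (φ := 5 * Real.pi / 12) (solWave_isWave 1 0)
    (fun ξ hξ => solWave_eq_zero hξ) (by rw [hQ]; norm_num) (by linarith) (by linarith)
    (fun ξ hξ => (wave_simple_zeros ξ hξ).1) (fun t ht ht3 => (u_neg_pos ht.le ht3).ne')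
    sin_tendsto_solWave_one_zero
  rwa [hQ, show Real.pi - 5 * Real.pi / 12 = 7 * Real.pi / 12 by ring] at h

theorem hasZeros_deriv_u : HasZeros (deriv u) (7 / 36) (13 * Real.pi / 12) := by
  have hQ : |(-(1 / 6 * (1 / 6 + 1)) : ℝ)| = 7 / 36 := by norm_num [abs]
  have hpi := Real.pi_pos
  have h := hasZeros_of_wave (f := deriv u) (derivWave_isWave 1 0)
    (fun ξ hξ => derivWave_eq_zero hξ) hQ.le le_rfl (by linarith)
    (fun ξ hξ => (wave_simple_zeros ξ hξ).2.2.1) (fun t ht ht3 => (deriv_u_neg_pos ht ht3).ne')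
    sin_tendsto_derivWave_one_zero
  rwa [hQ, show Real.pi - -(Real.pi / 12) = 13 * Real.pi / 12 by ring] at h

end CanonicalAiry

/-! ### Asymptotic expansions -/

namespace CanonicalAiry
open Set Topology

namespace HasZeros

variable {f : ℝ → ℝ} {q μ : ℝ}

theorem sub_le_xi (h : HasZeros f q μ) (hq : 0 ≤ q) (j : ℕ) :
    j * Real.pi + μ - q ≤ 2 / 3 * negZero f j ^ (3 / 2 : ℝ) := by
  have h1 := h.le_xi j
  have h2 : (0 : ℝ) ≤ j := Nat.cast_nonneg j
  have h3 := (abs_le.1 (h.xi_bound j)).1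
  have h4 := div_le_self hq (by linarith : 1 ≤ 2 / 3 * negZero f j ^ (3 / 2 : ℝ))
  linarith

theorem xi_mem_Icc (h : HasZeros f q μ) {j : ℕ} {B : ℝ}
    (hB : q / (2 / 3 * negZero f j ^ (3 / 2 : ℝ)) ≤ B) :
    2 / 3 * negZero f j ^ (3 / 2 : ℝ) ∈ Icc (μ + j * Real.pi - B) (μ + j * Real.pi + B) := by
  have h1 := abs_le.1 ((h.xi_bound j).trans hB)
  constructor <;> linarith

theorem abs_xi_sub_le (h : HasZeros f q μ) (hq : q ≤ 1) (j : ℕ) :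
    |2 / 3 * negZero f j ^ (3 / 2 : ℝ) - (j * Real.pi + μ)| ≤ 1 / ((j : ℝ) + 1) := by
  have h0 : (0 : ℝ) < (j : ℝ) + 1 := by positivity
  refine (h.xi_bound j).trans ?_
  exact div_le_div₀ zero_le_one hq h0 (h.le_xi j)

theorem setOf_eq (h : HasZeros f q μ) (h0 : f 0 ≠ 0) (hpos : ∀ x, 0 < x → f x ≠ 0) :
    {x | f x = 0} = range fun j => -negZero f j := by
  ext x
  simp only [mem_ofPred_eq, mem_range]
  rcases lt_trichotomy x 0 with hx | rfl | hx
  · have := h.zero_iff (-x) (neg_pos.2 hx)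
    rw [neg_neg] at this
    simp only [this, neg_eq_iff_eq_neg]
  · exact ⟨fun h1 => absurd h1 h0, fun ⟨j, hj⟩ => by linarith [h.pos j]⟩
  · exact ⟨fun h1 => absurd h1 (hpos x hx), fun ⟨j, hj⟩ => by linarith [h.pos j]⟩

theorem setOf_eq_union (h : HasZeros f q μ) (h0 : f 0 = 0) (hpos : ∀ x, 0 < x → f x ≠ 0) :
    {x | f x = 0} = (range fun j => -negZero f j) ∪ {0} := by
  ext x
  simp only [mem_ofPred_eq, mem_union, mem_range, mem_singleton_iff]
  rcases lt_trichotomy x 0 with hx | rfl | hx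
  · have := h.zero_iff (-x) (neg_pos.2 hx)
    rw [neg_neg] at this
    simp only [this, neg_eq_iff_eq_neg, hx.ne, or_false]
  · simp [h0]
  · refine ⟨fun h1 => absurd h1 (hpos x hx), ?_⟩
    rintro (⟨j, hj⟩ | hj)
    · linarith [h.pos j]
    · linarith

end HasZeros

/-- With `y = (1 + h)^{1/3}` the left-hand side is `(y - 1)² (2 y + 1) / 3`, and the right-hand side
is `(y - 1)² (y² + y + 1)²`. -/
theorem abs_rpow_two_thirds_sub_le {h : ℝ} (hh : 0 ≤ 1 + h) :
    |(1 + h) ^ (2 / 3 : ℝ) - 1 - 2 / 3 * h| ≤ h ^ 2 := by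
  set y : ℝ := (1 + h) ^ (1 / 3 : ℝ) with hy
  have hy0 : 0 ≤ y := by positivity
  have h3 : y ^ 3 = 1 + h := by
    rw [hy, ← Real.rpow_natCast, ← Real.rpow_mul hh]; norm_num
  have h2 : (1 + h) ^ (2 / 3 : ℝ) = y ^ 2 := by
    rw [hy, ← Real.rpow_natCast, ← Real.rpow_mul hh]; norm_num
  rw [h2]
  clear_value y
  clear hy h2
  obtain rfl : h = y ^ 3 - 1 := by linarith
  rw [show y ^ 2 - 1 - 2 / 3 * (y ^ 3 - 1) = -((y - 1) ^ 2 * ((2 * y + 1) / 3)) by ring,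
    abs_neg, abs_of_nonneg (by positivity),
    show (y ^ 3 - 1) ^ 2 = (y - 1) ^ 2 * (y ^ 2 + y + 1) ^ 2 by ring]
  refine mul_le_mul_of_nonneg_left ?_ (sq_nonneg _)
  nlinarith [pow_nonneg hy0 3, pow_nonneg hy0 4, sq_nonneg y]

/-- Expansion of `(3 x_n / 2)^{2/3}` for `x_n = λ n + μ + O(1/n)`. -/
theorem exists_expansion {x : ℕ → ℝ} {l μ K : ℝ} (hl : 0 < l) (hx0 : ∀ n, 0 ≤ x n)
    (hx : ∀ n : ℕ, 1 ≤ n → |x n - (n * l + μ)| ≤ K / n) :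
    ∃ r : ℕ → ℝ, r =O[atTop] (fun n : ℕ => 1 / (n : ℝ) ^ 2) ∧ ∀ n : ℕ, 1 ≤ n →
      (3 * x n / 2) ^ (2 / 3 : ℝ) =
        (3 * n * l / 2) ^ (2 / 3 : ℝ) * (1 + 2 * μ / (3 * l * n) + r n) := by
  refine ⟨fun n => (x n / (n * l)) ^ (2 / 3 : ℝ) - 1 - 2 * μ / (3 * l * n), ?_, fun n hn => ?_⟩
  · refine IsBigO.of_bound (((|μ| + K) / l) ^ 2 + 2 / 3 * (K / l)) ?_
    filter_upwards [eventually_ge_atTop 1] with n hn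
    have hn1 : (1 : ℝ) ≤ n := by exact_mod_cast hn
    have hn0 : (0 : ℝ) < n := by linarith
    have hnl : 0 < n * l := by positivity
    have hK : 0 ≤ K := by
      have := (abs_nonneg _).trans (hx n hn)
      by_contra hneg
      push Not at hneg
      linarith [div_neg_of_neg_of_pos hneg hn0]
    set h : ℝ := x n / (n * l) - 1 with hh
    have hh1 : 1 + h = x n / (n * l) := by rw [hh]; ring
    have h1 := abs_rpow_two_thirds_sub_le (h := h) (by rw [hh1]; have := hx0 n; positivity)
    rw [hh1] at h1
    have e2 : h - μ / (n * l) = (x n - (n * l + μ)) / (n * l) := by rw [hh]; field_simp; ring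
    have h2 : |h - μ / (n * l)| ≤ K / l / n ^ 2 := by
      rw [e2, abs_div, abs_of_pos hnl, div_le_iff₀ hnl]
      refine (hx n hn).trans (le_of_eq ?_)
      field_simp
    have h3 : |h| ≤ (|μ| + K) / l / n := by
      have h4 : K / l / n ^ 2 ≤ K / l / n := by
        gcongr
        nlinarith
      have h5 : |μ / (n * l)| = |μ| / l / n := by
        rw [abs_div, abs_of_pos hnl]; field_simp
      calc |h| = |(h - μ / (n * l)) + μ / (n * l)| := by rw [sub_add_cancel]
        _ ≤ |h - μ / (n * l)| + |μ / (n * l)| := abs_add_le _ _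
        _ ≤ K / l / n + |μ| / l / n := by rw [h5]; linarith
        _ = _ := by ring
    have h6 : h ^ 2 ≤ ((|μ| + K) / l / n) ^ 2 := by
      rw [← sq_abs h]; exact pow_le_pow_left₀ (abs_nonneg h) h3 2
    rw [Real.norm_eq_abs, Real.norm_of_nonneg (by positivity)]
    calc |(x n / (n * l)) ^ (2 / 3 : ℝ) - 1 - 2 * μ / (3 * l * n)|
        = |((x n / (n * l)) ^ (2 / 3 : ℝ) - 1 - 2 / 3 * h) + 2 / 3 * (h - μ / (n * l))| := by
          congr 1; field_simp; ring
      _ ≤ |(x n / (n * l)) ^ (2 / 3 : ℝ) - 1 - 2 / 3 * h| + 2 / 3 * |h - μ / (n * l)| := by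
          refine (abs_add_le _ _).trans (le_of_eq ?_)
          rw [abs_mul, abs_of_pos (by norm_num : (0 : ℝ) < 2 / 3)]
      _ ≤ ((|μ| + K) / l / n) ^ 2 + 2 / 3 * (K / l / n ^ 2) := by linarith
      _ = _ := by ring
  · have hn0 : (0 : ℝ) < n := by exact_mod_cast hn
    have hnl : 0 < n * l := by positivity
    rw [show 1 + 2 * μ / (3 * l * n) + ((x n / (n * l)) ^ (2 / 3 : ℝ) - 1 - 2 * μ / (3 * l * n))
      = (x n / (n * l)) ^ (2 / 3 : ℝ) by ring, ← Real.mul_rpow (by positivity)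
      (by have := hx0 n; positivity)]
    congr 1
    field_simp

theorem eq_rpow_xi {x : ℝ} (hx : 0 ≤ x) :
    x = (3 * (2 / 3 * x ^ (3 / 2 : ℝ)) / 2) ^ (2 / 3 : ℝ) := by
  rw [← airyArg_eq (by positivity), airyArg_xi hx]

theorem HasZeros.expansion {f : ℝ → ℝ} {q m : ℝ} (h : HasZeros f q (m * Real.pi / 12))
    (hq : q ≤ 1) :
    ∃ r : ℕ → ℝ, r =O[atTop] (fun j : ℕ => 1 / (j : ℝ) ^ 2) ∧ ∀ j : ℕ, 1 ≤ j →
      negZero f j = (3 * j * Real.pi / 2) ^ (2 / 3 : ℝ) *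
        (1 + m / (18 * (j : ℝ)) + r j) := by
  obtain ⟨r, hr, he⟩ := exists_expansion (x := fun j => 2 / 3 * negZero f j ^ (3 / 2 : ℝ))
    (l := Real.pi) (μ := m * Real.pi / 12) (K := 1) Real.pi_pos
    (fun j => by have := h.pos j; positivity) (fun j hj => by
      have hj0 : (0 : ℝ) < j := by exact_mod_cast hj
      refine (h.abs_xi_sub_le hq j).trans ?_
      exact one_div_le_one_div_of_le hj0 (by linarith))
  refine ⟨r, hr, fun j hj => ?_⟩
  have hj0 : (j : ℝ) ≠ 0 := by positivity
  have e : m / (18 * (j : ℝ)) = 2 * (m * Real.pi / 12) / (3 * Real.pi * j) := by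
    have := Real.pi_ne_zero
    field_simp
    ring
  rw [e, ← he j hj]
  exact eq_rpow_xi (h.pos j).le

theorem c_even (j : ℕ) : c (2 * j) = negZero (deriv v) j := by simp [c]

theorem c_odd (j : ℕ) : c (2 * j + 1) = negZero v j := by
  rw [c, if_neg (by simp), show (2 * j + 1) / 2 = j by omega]

theorem ct_even (j : ℕ) : ct (2 * j) = negZero u j := by simp [ct]

theorem ct_odd (j : ℕ) : ct (2 * j + 1) = negZero (deriv u) j := by
  rw [ct, if_neg (by simp), show (2 * j + 1) / 2 = j by omega]

theorem c_pos (p : ℕ) : 0 < c p := by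
  obtain ⟨j, rfl | rfl⟩ := Nat.even_or_odd' p
  · rw [c_even]; exact hasZeros_deriv_v.pos j
  · rw [c_odd]; exact hasZeros_v.pos j

theorem ct_pos (p : ℕ) : 0 < ct p := by
  obtain ⟨j, rfl | rfl⟩ := Nat.even_or_odd' p
  · rw [ct_even]; exact hasZeros_u.pos j
  · rw [ct_odd]; exact hasZeros_deriv_u.pos j

theorem one_div_succ_le {j p : ℕ} (hp : 1 ≤ p) (hpj : p ≤ 2 * j + 1) :
    1 / ((j : ℝ) + 1) ≤ 2 / p := by
  have h0 : (0 : ℝ) < p := by exact_mod_cast hp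
  have h1 : (p : ℝ) ≤ 2 * j + 1 := by exact_mod_cast hpj
  rw [div_le_div_iff₀ (by positivity) h0]
  linarith

theorem abs_xi_sub_le (p : ℕ) (hp : 1 ≤ p) :
    |xi p - (p * (Real.pi / 2) + 5 * Real.pi / 12)| ≤ 2 / p := by
  obtain ⟨j, hj⟩ := Nat.even_or_odd' p
  have h2 := one_div_succ_le (j := j) hp (by omega)
  refine le_trans ?_ h2
  rcases hj with rfl | rfl
  · have h1 := hasZeros_deriv_v.abs_xi_sub_le (by norm_num) j
    rw [xi, c_even]
    convert! h1 using 3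
    push_cast; ring
  · have h1 := hasZeros_v.abs_xi_sub_le (by norm_num) j
    rw [xi, c_odd]
    convert! h1 using 3
    push_cast; ring

theorem abs_xit_sub_le (p : ℕ) (hp : 1 ≤ p) :
    |xit p - (p * (Real.pi / 2) + 7 * Real.pi / 12)| ≤ 2 / p := by
  obtain ⟨j, hj⟩ := Nat.even_or_odd' p
  have h2 := one_div_succ_le (j := j) hp (by omega)
  refine le_trans ?_ h2
  rcases hj with rfl | rfl
  · have h1 := hasZeros_u.abs_xi_sub_le (by norm_num) j
    rw [xit, ct_even]
    convert! h1 using 3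
    push_cast; ring
  · have h1 := hasZeros_deriv_u.abs_xi_sub_le (by norm_num) j
    rw [xit, ct_odd]
    convert! h1 using 3
    push_cast; ring

theorem c_expansion : ∃ r : ℕ → ℝ, r =O[atTop] (fun p : ℕ => 1 / (p : ℝ) ^ 2) ∧
    ∀ p : ℕ, 1 ≤ p → c p = (3 * p * Real.pi / 4) ^ (2 / 3 : ℝ) * (1 + 5 / 9 / p + r p) := by
  obtain ⟨r, hr, he⟩ := exists_expansion (half_pos Real.pi_pos)
    (fun p => by have := c_pos p; rw [xi]; positivity) abs_xi_sub_le
  refine ⟨r, hr, fun p hp => ?_⟩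
  have h := he p hp
  rw [xi, ← eq_rpow_xi (c_pos p).le] at h
  have hp0 : (p : ℝ) ≠ 0 := by positivity
  rw [h]
  congr 2
  · ring
  · have := Real.pi_ne_zero
    field_simp
    ring

theorem ct_expansion : ∃ r : ℕ → ℝ, r =O[atTop] (fun p : ℕ => 1 / (p : ℝ) ^ 2) ∧
    ∀ p : ℕ, 1 ≤ p → ct p = (3 * p * Real.pi / 4) ^ (2 / 3 : ℝ) * (1 + 7 / 9 / p + r p) := by
  obtain ⟨r, hr, he⟩ := exists_expansion (half_pos Real.pi_pos)
    (fun p => by have := ct_pos p; rw [xit]; positivity) abs_xit_sub_le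
  refine ⟨r, hr, fun p hp => ?_⟩
  have h := he p hp
  rw [xit, ← eq_rpow_xi (ct_pos p).le] at h
  have hp0 : (p : ℝ) ≠ 0 := by positivity
  rw [h]
  congr 2
  · ring
  · have := Real.pi_ne_zero
    field_simp
    ring

theorem three_mul_rpow (p : ℕ) : (3 * p * Real.pi / 4) ^ (2 / 3 : ℝ) =
    (3 * Real.pi / 4) ^ (2 / 3 : ℝ) * (p : ℝ) ^ (2 / 3 : ℝ) := by
  rw [← Real.mul_rpow (by positivity) (by positivity)]
  congr 1; ring

theorem gap_constant_eq : (Real.pi / (9 * √2)) ^ (2 / 3 : ℝ) =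
    (3 * Real.pi / 4) ^ (2 / 3 : ℝ) * (2 / 9) := by
  have h2 : √2 * √2 = 2 := Real.mul_self_sqrt (by norm_num)
  have hs : 0 < √2 := by positivity
  have e : (2 / 9 : ℝ) = ((√2 / 3) ^ (3 : ℝ)) ^ (2 / 3 : ℝ) := by
    rw [← Real.rpow_mul (by positivity)]
    norm_num
    rw [div_pow, sq, h2]; norm_num
  rw [e, ← Real.mul_rpow (by positivity) (by positivity)]
  congr 1
  norm_num
  field_simp
  ring_nf
  rw [show √2 ^ 4 = (√2 * √2) * (√2 * √2) by ring, h2]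
  norm_num

theorem isBigO_rpow_mul {r : ℕ → ℝ} {n : ℕ} (A : ℝ)
    (hr : r =O[atTop] fun p : ℕ => 1 / (p : ℝ) ^ n) {s : ℝ} (hs : s = n - 2 / 3) :
    (fun p : ℕ => A * (p : ℝ) ^ (2 / 3 : ℝ) * r p) =O[atTop] fun p : ℕ => 1 / (p : ℝ) ^ s := by
  have h1 : (fun p : ℕ => A * (p : ℝ) ^ (2 / 3 : ℝ)) =O[atTop] fun p : ℕ => (p : ℝ) ^ (2 / 3 : ℝ) :=
    isBigO_const_mul_self A _ _
  refine (h1.mul hr).congr' EventuallyEq.rfl ?_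
  filter_upwards [eventually_ge_atTop 1] with p hp
  have hp0 : (0 : ℝ) < p := by exact_mod_cast hp
  rw [hs, Real.rpow_sub hp0, Real.rpow_natCast]
  field_simp

theorem c_sub_isBigO : (fun p : ℕ => c p - (3 * p * Real.pi / 4) ^ (2 / 3 : ℝ))
    =O[atTop] (fun p : ℕ => 1 / (p : ℝ) ^ (1 / 3 : ℝ)) := by
  obtain ⟨r, hr, he⟩ := c_expansion
  have h1 : (fun p : ℕ => 5 / 9 / (p : ℝ)) =O[atTop] fun p : ℕ => 1 / (p : ℝ) ^ 1 := by
    simpa [div_eq_mul_inv] using isBigO_const_mul_self (5 / 9 : ℝ) (fun p : ℕ => (p : ℝ)⁻¹) atTop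
  have h2 : (fun p : ℕ => 1 / (p : ℝ) ^ 2) =O[atTop] fun p : ℕ => 1 / (p : ℝ) ^ 1 := by
    refine IsBigO.of_bound 1 ?_
    filter_upwards [eventually_ge_atTop 1] with p hp
    have hp1 : (1 : ℝ) ≤ p := by exact_mod_cast hp
    rw [one_mul, Real.norm_of_nonneg (by positivity), Real.norm_of_nonneg (by positivity)]
    exact one_div_le_one_div_of_le (by positivity) (pow_le_pow_right₀ hp1 (by norm_num))
  refine (isBigO_rpow_mul ((3 * Real.pi / 4) ^ (2 / 3 : ℝ)) (h1.add (hr.trans h2))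
    (by norm_num)).congr' ?_ EventuallyEq.rfl
  filter_upwards [eventually_ge_atTop 1] with p hp
  rw [he p hp, three_mul_rpow]
  ring

theorem ct_sub_c_isBigO : (fun p : ℕ => ct p - c p -
    (Real.pi / (9 * √2)) ^ (2 / 3 : ℝ) * (1 / (p : ℝ) ^ (1 / 3 : ℝ)))
      =O[atTop] (fun p : ℕ => 1 / (p : ℝ) ^ (4 / 3 : ℝ)) := by
  obtain ⟨r, hr, he⟩ := c_expansion
  obtain ⟨r', hr', he'⟩ := ct_expansion
  refine (isBigO_rpow_mul ((3 * Real.pi / 4) ^ (2 / 3 : ℝ)) (hr'.sub hr)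
    (by norm_num)).congr' ?_ EventuallyEq.rfl
  filter_upwards [eventually_ge_atTop 1] with p hp
  have hp0 : (0 : ℝ) < p := by exact_mod_cast hp
  have e : 1 / (p : ℝ) ^ (1 / 3 : ℝ) = (p : ℝ) ^ (2 / 3 : ℝ) / p := by
    rw [← Real.rpow_sub_one hp0.ne', one_div, ← Real.rpow_neg hp0.le]; norm_num
  rw [he p hp, he' p hp, three_mul_rpow, gap_constant_eq, e]
  ring

end CanonicalAiry

theorem mainTheorem10 :
    -- the sequences list exactly the zeroes of `v'`, `v`, `u`, `u'`, in decreasing order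
    ((StrictMono fun j : ℕ => CanonicalAiry.c (2 * j)) ∧
      (StrictMono fun j : ℕ => CanonicalAiry.c (2 * j + 1)) ∧
      (StrictMono fun j : ℕ => CanonicalAiry.ct (2 * j)) ∧
      (StrictMono fun j : ℕ => CanonicalAiry.ct (2 * j + 1)) ∧
      (∀ p : ℕ, 0 < CanonicalAiry.c p ∧ 0 < CanonicalAiry.ct p) ∧
      {x : ℝ | deriv CanonicalAiry.v x = 0} =
        Set.range (fun j : ℕ => -CanonicalAiry.c (2 * j)) ∧
      {x : ℝ | CanonicalAiry.v x = 0} =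
        Set.range (fun j : ℕ => -CanonicalAiry.c (2 * j + 1)) ∪ {0} ∧
      {x : ℝ | CanonicalAiry.u x = 0} =
        Set.range (fun j : ℕ => -CanonicalAiry.ct (2 * j)) ∧
      {x : ℝ | deriv CanonicalAiry.u x = 0} =
        Set.range (fun j : ℕ => -CanonicalAiry.ct (2 * j + 1)) ∪ {0}) ∧
    -- explicit intervals
    (∀ j : ℕ, CanonicalAiry.xi (2 * j) ∈ Set.Icc
      (5 * Real.pi / 12 + j * Real.pi - 7 / (12 * (j * Real.pi + Real.pi / 3)))
      (5 * Real.pi / 12 + j * Real.pi + 7 / (12 * (j * Real.pi + Real.pi / 3)))) ∧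
    (∀ j : ℕ, CanonicalAiry.xi (2 * j + 1) ∈ Set.Icc
      (11 * Real.pi / 12 + j * Real.pi - 5 / (36 * (j * Real.pi + 5 * Real.pi / 6)))
      (11 * Real.pi / 12 + j * Real.pi + 5 / (36 * (j * Real.pi + 5 * Real.pi / 6)))) ∧
    (∀ j : ℕ, CanonicalAiry.xit (2 * j) ∈ Set.Icc
      (7 * Real.pi / 12 + j * Real.pi - 5 / (36 * (j * Real.pi + Real.pi / 2)))
      (7 * Real.pi / 12 + j * Real.pi + 5 / (36 * (j * Real.pi + Real.pi / 2)))) ∧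
    (∀ j : ℕ, CanonicalAiry.xit (2 * j + 1) ∈ Set.Icc
      (13 * Real.pi / 12 + j * Real.pi - 7 / (12 * (((j : ℝ) + 1) * Real.pi)))
      (13 * Real.pi / 12 + j * Real.pi + 7 / (12 * (((j : ℝ) + 1) * Real.pi)))) ∧
    -- expansions along the even and the odd indices
    (∃ r : ℕ → ℝ, r =O[atTop] (fun j : ℕ => 1 / (j : ℝ) ^ 2) ∧ ∀ j : ℕ, 1 ≤ j →
      CanonicalAiry.c (2 * j) =
        (3 * j * Real.pi / 2) ^ (2 / 3 : ℝ) * (1 + 5 / (18 * (j : ℝ)) + r j)) ∧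
    (∃ r : ℕ → ℝ, r =O[atTop] (fun j : ℕ => 1 / (j : ℝ) ^ 2) ∧ ∀ j : ℕ, 1 ≤ j →
      CanonicalAiry.c (2 * j + 1) =
        (3 * j * Real.pi / 2) ^ (2 / 3 : ℝ) * (1 + 11 / (18 * (j : ℝ)) + r j)) ∧
    (∃ r : ℕ → ℝ, r =O[atTop] (fun j : ℕ => 1 / (j : ℝ) ^ 2) ∧ ∀ j : ℕ, 1 ≤ j →
      CanonicalAiry.ct (2 * j) =
        (3 * j * Real.pi / 2) ^ (2 / 3 : ℝ) * (1 + 7 / (18 * (j : ℝ)) + r j)) ∧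
    (∃ r : ℕ → ℝ, r =O[atTop] (fun j : ℕ => 1 / (j : ℝ) ^ 2) ∧ ∀ j : ℕ, 1 ≤ j →
      CanonicalAiry.ct (2 * j + 1) =
        (3 * j * Real.pi / 2) ^ (2 / 3 : ℝ) * (1 + 13 / (18 * (j : ℝ)) + r j)) ∧
    -- expansions along all indices
    (fun p : ℕ => CanonicalAiry.c p - (3 * p * Real.pi / 4) ^ (2 / 3 : ℝ))
      =O[atTop] (fun p : ℕ => 1 / (p : ℝ) ^ (1 / 3 : ℝ)) ∧
    (fun p : ℕ => CanonicalAiry.ct p - CanonicalAiry.c p -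
        (Real.pi / (9 * √2)) ^ (2 / 3 : ℝ) * (1 / (p : ℝ) ^ (1 / 3 : ℝ)))
      =O[atTop] (fun p : ℕ => 1 / (p : ℝ) ^ (4 / 3 : ℝ)) := by
  have hv' := CanonicalAiry.hasZeros_deriv_v
  have hv := CanonicalAiry.hasZeros_v
  have hu := CanonicalAiry.hasZeros_u
  have hu' := CanonicalAiry.hasZeros_deriv_u
  have hpi := Real.pi_pos
  have hpi3 := Real.pi_gt_three
  have hne_u := fun x (hx : 0 < x) => mul_ne_zero_iff.1 (CanonicalAiry.u_mul_deriv_pos hx).ne'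
  have hne_v := fun x (hx : 0 < x) => mul_ne_zero_iff.1 (CanonicalAiry.v_mul_deriv_pos hx).ne'
  have hj0 : ∀ j : ℕ, (0 : ℝ) ≤ j * Real.pi := fun j => by positivity
  simp only [CanonicalAiry.xi, CanonicalAiry.xit, CanonicalAiry.c_even, CanonicalAiry.c_odd,
    CanonicalAiry.ct_even, CanonicalAiry.ct_odd]
  refine ⟨⟨hv'.strictMono, hv.strictMono, hu.strictMono, hu'.strictMono,
    fun p => ⟨CanonicalAiry.c_pos p, CanonicalAiry.ct_pos p⟩,
    hv'.setOf_eq ?_ fun x hx => (hne_v x hx).2, hv.setOf_eq_union ?_ fun x hx => (hne_v x hx).1,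
    hu.setOf_eq ?_ fun x hx => (hne_u x hx).1, hu'.setOf_eq_union ?_ fun x hx => (hne_u x hx).2⟩,
    fun j => hv'.xi_mem_Icc ?_, fun j => hv.xi_mem_Icc ?_, fun j => hu.xi_mem_Icc ?_,
    fun j => hu'.xi_mem_Icc ?_, ?_, ?_, ?_, ?_, CanonicalAiry.c_sub_isBigO,
    CanonicalAiry.ct_sub_c_isBigO⟩
  · simp [CanonicalAiry.v, CanonicalAiry.deriv_sol_zero]
  · simp [CanonicalAiry.v, CanonicalAiry.sol_zero]
  · simp [CanonicalAiry.u, CanonicalAiry.sol_zero]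
  · simp [CanonicalAiry.u, CanonicalAiry.deriv_sol_zero]
  · have h1 := hv'.sub_le_xi (by norm_num) j
    have h2 := hj0 j
    rw [div_le_div_iff₀ (by linarith) (by positivity)]
    linarith
  · have h1 := hv.sub_le_xi (by norm_num) j
    have h2 := hj0 j
    rw [div_le_div_iff₀ (by linarith) (by positivity)]
    linarith
  · have h1 := hu.sub_le_xi (by norm_num) j
    have h2 := hj0 j
    rw [div_le_div_iff₀ (by linarith) (by positivity)]
    linarith
  · have h1 := hu'.sub_le_xi (by norm_num) j
    have h2 := hj0 j
    rw [div_le_div_iff₀ (by linarith) (by positivity)]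
    linarith
  · exact hv'.expansion (by norm_num)
  · exact hv.expansion (by norm_num)
  · exact hu.expansion (by norm_num)
  · exact hu'.expansion (by norm_num)
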